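/- Call a nonempty connected open set a domain, and let $\widehat{\mathbb C}=\mathbb C\cup\{\infty\}$ be the Riemann sphere. For $A\ge 1$, a domain $\Omega\subset\mathbb C$ is $A$-uniform if any two points $a,b\in\Omega$ can be joined by a continuous curve $\gamma\colon[0,1]\to\Omega$ with $\gamma(0)=a$, $\gamma(1)=b$, with Euclidean length $\ell(\gamma)\le A|a-b|$, and such that for every $t\in[0,1]$ the open disc centred at $\gamma(t)$ of radius $A^{-1}\min\{\ell(\gamma|_{[0,t]}),\ell(\gamma|_{[t,1]})\}$ is contained in $\Omega$. A circle domain is a domain in $\widehat{\mathbb C}$ each of whose boundary components is a circle of $\widehat{\mathbb C}$ or a single point. An $A$-uniform circle domain is an $A$-uniform domain in $\mathbb C$ that, regarded as a subset of $\widehat{\mathbb C}$, is a circle domain. Given domains $D_n\subset\widehat{\mathbb C}$, $n\in\mathbb N$, with $\infty\in D_n$, the $\infty$-kernel of $\{D_n\}$ is the union of all domains $U\subset\widehat{\mathbb C}$ with $\infty\in U$ such that for each compact $K\subset U$ there is $N$ with $K\subset D_n$ for all $n\ge N$. The sequence $\{D_n\}$ converges to a domain $D\subset\widehat{\mathbb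 C}$ in the Carathéodory sense with base at $\infty$ if $D$ is the $\infty$-kernel of every subsequence of $\{D_n\}$. **Corollary 3.6.** Let $A\ge1$ and let $D_n\subset\widehat{\mathbb C}$, $n\in\mathbb N$, be domains such that $\infty\in D_n$ and $D_n\cap\mathbb C$ is an $A$-uniform circle domain for each $n\in\mathbb N$. Suppose that $\{D_n\}$ converges to a domain $D\subset\widehat{\mathbb C}$ in the Carathéodory sense with base at $\infty$. Then $D\cap\mathbb C$ is an $A$-uniform circle domain (with the same constant $A$). -/

import Mathlib

open Set
open scoped ENNReal

/-- The Riemann sphere, as the one-point compactification of the complex plane. -/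
abbrev RiemannSphere : Type := OnePoint ℂ

/-- A domain: a nonempty connected open set. -/
def IsRegion {X : Type*} [TopologicalSpace X] (U : Set X) : Prop :=
  IsOpen U ∧ IsConnected U

/-- The part of a subset of the Riemann sphere that lies in `ℂ`. -/
def finitePart (D : Set RiemannSphere) : Set ℂ :=
  ((↑) : ℂ → RiemannSphere) ⁻¹' D

/-- The length `A`-cigar of a curve `γ : [0,1] → ℂ`: the union over `t ∈ [0,1]` of the open balls
centred at `γ t` of radius `A⁻¹ * min (ℓ(γ|[0,t])) (ℓ(γ|[t,1]))`. The length is the total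
variation, with values in `[0,∞]`. -/
noncomputable def lengthCigar (A : ℝ) (γ : ℝ → ℂ) : Set ℂ :=
  ⋃ t ∈ Icc (0 : ℝ) 1,
    Metric.eball (γ t)
      ((ENNReal.ofReal A)⁻¹ * min (eVariationOn γ (Icc 0 t)) (eVariationOn γ (Icc t 1)))

/-- `γ`, restricted to `[0,1]`, is an `A`-uniform curve in `Ω`. -/
structure IsUniformCurve (A : ℝ) (Ω : Set ℂ) (γ : ℝ → ℂ) : Prop where
  continuousOn : ContinuousOn γ (Icc 0 1)
  mapsTo : MapsTo γ (Icc 0 1) Ω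
  length_le : eVariationOn γ (Icc 0 1) ≤ ENNReal.ofReal (A * dist (γ 0) (γ 1))
  cigar_subset : lengthCigar A γ ⊆ Ω

/-- `Ω` is a (Euclidean) `A`-uniform domain in the plane. -/
def IsUniformDomain (A : ℝ) (Ω : Set ℂ) : Prop :=
  IsRegion Ω ∧ ∀ a ∈ Ω, ∀ b ∈ Ω, ∃ γ : ℝ → ℂ, γ 0 = a ∧ γ 1 = b ∧ IsUniformCurve A Ω γ

/-- A circle in the Riemann sphere: a Euclidean circle of positive radius, or a line together
with the point at infinity. -/
def IsSphereCircle (C : Set RiemannSphere) : Prop :=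
  (∃ (c : ℂ) (r : ℝ), 0 < r ∧ C = ((↑) : ℂ → RiemannSphere) '' Metric.sphere c r) ∨
    (∃ a v : ℂ, v ≠ 0 ∧
      C = insert OnePoint.infty
        (((↑) : ℂ → RiemannSphere) '' range (fun t : ℝ => a + (t : ℂ) * v)))

/-- A circle domain: a domain in the Riemann sphere such that each connected component of its
boundary (taken in the sphere) is a circle or a single point. -/
def IsCircleDomain (Ω : Set RiemannSphere) : Prop :=
  IsRegion Ω ∧ ∀ p ∈ frontier Ω,
    IsSphereCircle (connectedComponentIn (frontier Ω) p) ∨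
      connectedComponentIn (frontier Ω) p = {p}

/-- `Ω ⊆ ℂ` is an `A`-uniform circle domain: it is an `A`-uniform domain and, regarded as a subset
of the sphere, a circle domain. -/
def IsUniformCircleDomain (A : ℝ) (Ω : Set ℂ) : Prop :=
  IsUniformDomain A Ω ∧ IsCircleDomain (((↑) : ℂ → RiemannSphere) '' Ω)

/-- The `z₀`-kernel of a sequence of sets: the union of all domains `U` containing `z₀` such that
every compact subset of `U` is contained in `Ω n` for all large `n`. -/
def caratheodoryKernel (z₀ : RiemannSphere) (Ω : ℕ → Set RiemannSphere) : Set RiemannSphere :=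
  ⋃₀ {U | IsRegion U ∧ z₀ ∈ U ∧
    ∀ K ⊆ U, IsCompact K → ∃ N : ℕ, ∀ n ≥ N, K ⊆ Ω n}

/-- Carathéodory convergence with base at `z₀`: `D` is the `z₀`-kernel of every subsequence. -/
def CaratheodoryConverges (z₀ : RiemannSphere) (Ω : ℕ → Set RiemannSphere)
    (D : Set RiemannSphere) : Prop :=
  ∀ φ : ℕ → ℕ, StrictMono φ → caratheodoryKernel z₀ (Ω ∘ φ) = D

/-! Uniformity survives the limit by compactness. Uniform curves with fixed endpoints, run at
constant speed on `[0,1]`, have Lipschitz constants at most `A * dist a b`, so they have a pointwise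
limit along an ultrafilter, which inherits the length bound and the cigar balls with the same `A`.
The limit curve lies in `frequentInterior`, and connectedness puts it in the kernel
(`exists_isSteadyCurve_of_mem_frequentInterior`). The argument also shows that the kernel is all of
`frequentInterior`, from which it follows that balls outside the kernel are, after halving, avoided
by almost all terms (`eventually_disjoint_ball`).

For the boundary, the exterior of each term is a union of round discs whose circles lie in the
closure of the term (`HasCircularBoundary.exists_isHoleDisc`). The discs around a fixed exterior
point of the limit converge along an ultrafilter, so the exterior of the limit has the same form
(`PlanarKernelLimit.exists_isHoleDisc`).

This does not yet determine the boundary components. If two points `p ≠ q` of one component lay on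
no common hole circle, a branch of `log ((z - p) / (z - q))` on the limit domain would extend to its
boundary by uniformity, then across every hole disc, hence to the plane without `p` and `q`, which
is impossible (`HasSteadyCurves.exists_isHoleDisc_of_isPreconnected`). So any two points of a
component share a hole circle. Three pairwise disjoint discs have no common boundary point, and this
forces the component to be a point or one circle (`HasSteadyCurves.hasCircularBoundary`).

The arguments about holes and boundary continua all run through continuous logarithms, that is,
lifts through the covering `Complex.exp`. -/

open Filter Topology Metric

/-! ### Carathéodory convergence in planar terms -/

/-- The points having a neighbourhood that lies in infinitely many terms of the sequence. -/
def frequentInterior (Ω : ℕ → Set ℂ) : Set ℂ :=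
  {z | ∃ ε > 0, ∃ᶠ n in atTop, ball z ε ⊆ Ω n}

/-- The planar form of Carathéodory convergence with base at infinity: `Ω` is the limit of
`Ωs` near infinity and near each of its points, and it swallows every ball that it meets and
that lies in infinitely many terms. -/
structure PlanarKernelLimit (Ωs : ℕ → Set ℂ) (Ω : Set ℂ) : Prop where
  exists_radius : ∃ R : ℝ, 0 < R ∧ (∀ z : ℂ, R ≤ ‖z‖ → z ∈ Ω) ∧
    ∀ᶠ n in atTop, ∀ z : ℂ, R ≤ ‖z‖ → z ∈ Ωs n
  eventually_ball : ∀ z ∈ Ω, ∃ ε > 0, ∀ᶠ n in atTop, ball z ε ⊆ Ωs n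
  isOpen : IsOpen Ω
  ball_subset : ∀ (z : ℂ) (ε : ℝ), (ball z ε ∩ Ω).Nonempty →
    (∃ᶠ n in atTop, ball z ε ⊆ Ωs n) → ball z ε ⊆ Ω

theorem isCompact_eventually_subset {X : Type*} [TopologicalSpace X] {S : ℕ → Set X} {K : Set X}
    (hK : IsCompact K) (h : ∀ x ∈ K, ∃ W ∈ 𝓝 x, ∀ᶠ n in atTop, W ⊆ S n) :
    ∀ᶠ n in atTop, K ⊆ S n := by
  refine hK.induction_on (p := fun s => ∀ᶠ n in atTop, s ⊆ S n) ?_ ?_ ?_ ?_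
  · simp
  · intro s t hst ht
    exact ht.mono fun n hn => hst.trans hn
  · intro s t hs ht
    filter_upwards [hs, ht] with n h1 h2 using union_subset h1 h2
  · intro x hx
    obtain ⟨W, hW, hn⟩ := h x hx
    exact ⟨W, mem_nhdsWithin_of_mem_nhds hW, hn⟩

theorem caratheodoryKernel_exists_nhds {z₀ : RiemannSphere} {S : ℕ → Set RiemannSphere}
    {x : RiemannSphere} (hx : x ∈ caratheodoryKernel z₀ S) :
    ∃ W ∈ 𝓝 x, ∀ᶠ n in atTop, W ⊆ S n := by
  obtain ⟨U, ⟨hU, -, hK⟩, hxU⟩ := hx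
  obtain ⟨K, hKx, hKc, hKU⟩ := exists_mem_nhds_isCompact_mapsTo (f := id) continuous_id
    (hU.1.mem_nhds hxU)
  obtain ⟨N, hN⟩ := hK K hKU hKc
  exact ⟨K, hKx, eventually_atTop.2 ⟨N, hN⟩⟩

theorem CaratheodoryConverges.planarKernelLimit {S : ℕ → Set RiemannSphere}
    {D : Set RiemannSphere} (hD : IsRegion D) (h : CaratheodoryConverges OnePoint.infty S D) :
    OnePoint.infty ∈ D ∧ PlanarKernelLimit (fun n => finitePart (S n)) (finitePart D) := by
  have hid : caratheodoryKernel OnePoint.infty S = D := h id strictMono_id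
  have hinf : OnePoint.infty ∈ D := by
    obtain ⟨x, hx⟩ := hD.2.nonempty
    rw [← hid] at hx ⊢
    obtain ⟨U, hU, -⟩ := hx
    exact ⟨U, hU, hU.2.1⟩
  have hloc : ∀ x ∈ D, ∃ W ∈ 𝓝 x, ∀ᶠ n in atTop, W ⊆ S n := fun x hx =>
    caratheodoryKernel_exists_nhds (hid ▸ hx)
  refine ⟨hinf, ?_, ?_, ?_, ?_⟩
  · obtain ⟨W, hW, hn⟩ := hloc _ hinf
    have hWD : W ∩ D ∈ 𝓝 (OnePoint.infty : RiemannSphere) := inter_mem hW (hD.1.mem_nhds hinf)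
    obtain ⟨K, ⟨-, hK⟩, hsub⟩ := OnePoint.hasBasis_nhds_infty.mem_iff.1 hWD
    obtain ⟨R, hR⟩ := hK.isBounded.subset_ball 0
    have key : ∀ z : ℂ, max R 1 ≤ ‖z‖ → (z : RiemannSphere) ∈ W ∩ D := by
      intro z hz
      refine hsub (Or.inl ⟨z, fun hzK => ?_, rfl⟩)
      have := hR hzK
      rw [mem_ball_zero_iff] at this
      linarith [le_max_left R 1]
    exact ⟨max R 1, by positivity, fun z hz => (key z hz).2,
      hn.mono fun n hW' z hz => hW' (key z hz).1⟩
  · intro z hz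
    obtain ⟨W, hW, hn⟩ := hloc _ hz
    obtain ⟨ε, hε, hb⟩ := Metric.mem_nhds_iff.1
      (OnePoint.continuous_coe.continuousAt.preimage_mem_nhds hW)
    exact ⟨ε, hε, hn.mono fun n h' w hw => h' (hb hw)⟩
  · exact hD.1.preimage OnePoint.continuous_coe
  · rintro z ε ⟨w, hwb, hwD⟩ hfr
    obtain ⟨φ, hφ, hsub⟩ := extraction_of_frequently_atTop hfr
    have hker := h φ hφ
    set B : Set RiemannSphere := ((↑) : ℂ → RiemannSphere) '' ball z ε
    have hB : IsOpen B := OnePoint.isOpenMap_coe _ isOpen_ball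
    have hε : 0 < ε := pos_of_mem_ball hwb
    have hBconn : IsConnected B :=
      ((convex_ball z ε).isConnected ⟨z, mem_ball_self hε⟩).image _
        OnePoint.continuous_coe.continuousOn
    -- `D ∪ B` competes in the kernel of the subsequence along which the ball lies in the terms, and
    -- that kernel is again `D`. This is where convergence of every subsequence is needed.
    have hmem : D ∪ B ∈ {U | IsRegion U ∧ OnePoint.infty ∈ U ∧
        ∀ K ⊆ U, IsCompact K → ∃ N : ℕ, ∀ n ≥ N, K ⊆ (S ∘ φ) n} := by
      refine ⟨⟨hD.1.union hB, ?_⟩, Or.inl hinf, fun K hKU hK => ?_⟩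
      · exact hD.2.union ⟨(w : RiemannSphere), hwD, mem_image_of_mem _ hwb⟩ hBconn
      · refine eventually_atTop.1 (isCompact_eventually_subset hK fun x hx => ?_)
        rcases hKU hx with hxD | hxB
        · rw [← hker] at hxD
          exact caratheodoryKernel_exists_nhds hxD
        · refine ⟨B, hB.mem_nhds hxB, Eventually.of_forall fun n => ?_⟩
          rintro _ ⟨y, hy, rfl⟩
          exact hsub n hy
    intro y hy
    have : (y : RiemannSphere) ∈ caratheodoryKernel OnePoint.infty (S ∘ φ) :=
      ⟨D ∪ B, hmem, Or.inr ⟨y, hy, rfl⟩⟩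
    rwa [hker] at this

namespace PlanarKernelLimit

variable {Ωs : ℕ → Set ℂ} {Ω : Set ℂ}

theorem subset_frequentInterior (h : PlanarKernelLimit Ωs Ω) : Ω ⊆ frequentInterior Ωs :=
  fun z hz => by
    obtain ⟨ε, hε, hn⟩ := h.eventually_ball z hz
    exact ⟨ε, hε, hn.frequently⟩

/-- `frequentInterior Ωs \ Ω` is open: a ball lying in infinitely many terms and centred off `Ω`
cannot meet `Ω`, since it would be swallowed. So `Ω` is relatively clopen in `frequentInterior Ωs`.
-/
theorem isPreconnected_subset (h : PlanarKernelLimit Ωs Ω) {X : Set ℂ} (hX : IsPreconnected X)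
    (hsub : X ⊆ frequentInterior Ωs) (hne : (X ∩ Ω).Nonempty) : X ⊆ Ω := by
  have hopen : IsOpen (frequentInterior Ωs \ Ω) := by
    rw [Metric.isOpen_iff]
    rintro z ⟨⟨ε, hε, hn⟩, hz⟩
    have hdisj : ¬ (ball z ε ∩ Ω).Nonempty := fun hne' =>
      hz (h.ball_subset z ε hne' hn (mem_ball_self hε))
    refine ⟨ε, hε, fun w hw => ⟨?_, fun hwΩ => hdisj ⟨w, hw, hwΩ⟩⟩⟩
    obtain ⟨δ, hδ, hδ'⟩ := Metric.isOpen_iff.1 isOpen_ball w hw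
    exact ⟨δ, hδ, hn.mono fun n hb => hδ'.trans hb⟩
  refine hX.subset_left_of_subset_union h.isOpen hopen disjoint_sdiff_right ?_ hne
  intro x hx
  by_cases hxΩ : x ∈ Ω
  · exact Or.inl hxΩ
  · exact Or.inr ⟨hsub hx, hxΩ⟩

end PlanarKernelLimit

/-! ### Uniform curves at constant speed -/

/-- Two points of `Ω` are joined by a curve on `[0,1]` that is Lipschitz with the constant
`L ≤ A * dist a b`, and whose points are far from the complement of `Ω`, compared with the
time to the endpoints. -/
structure IsSteadyCurve (A : ℝ) (Ω : Set ℂ) (a b : ℂ) (L : ℝ) (β : ℝ → ℂ) : Prop where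
  length_nonneg : 0 ≤ L
  length_le : L ≤ A * dist a b
  zero : β 0 = a
  one : β 1 = b
  dist_le : ∀ s ∈ Icc (0 : ℝ) 1, ∀ t ∈ Icc (0 : ℝ) 1, dist (β s) (β t) ≤ L * |s - t|
  ball_subset : ∀ t ∈ Icc (0 : ℝ) 1, ball (β t) (A⁻¹ * (L * min t (1 - t))) ⊆ Ω

theorem continuousOn_eVariationOn_Icc_zero {γ : ℝ → ℂ} (hγ : ContinuousOn γ (Icc 0 1))
    (hfin : eVariationOn γ (Icc 0 1) ≠ ∞) :
    ContinuousOn (fun t => (eVariationOn γ (Icc 0 t)).toReal) (Icc 0 1) := by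
  have hb : BoundedVariationOn γ (Icc 0 1) := hfin
  have hle : ∀ {x y : ℝ}, 0 ≤ x → y ≤ 1 → eVariationOn γ (Icc x y) ≠ ∞ := fun hx hy =>
    ne_top_of_le_ne_top hfin (eVariationOn.mono γ (Icc_subset_Icc hx hy))
  have hadd : ∀ {x y : ℝ}, 0 ≤ x → x ≤ y → y ≤ 1 → (eVariationOn γ (Icc 0 y)).toReal =
      (eVariationOn γ (Icc 0 x)).toReal + (eVariationOn γ (Icc x y)).toReal := by
    intro x y hx hxy hy
    have := eVariationOn.Icc_add_Icc γ (s := univ) hx hxy (mem_univ x)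
    simp only [univ_inter] at this
    rw [← this, ENNReal.toReal_add (hle le_rfl (hxy.trans hy)) (hle hx hy)]
  intro x hx
  have h1 := hb.tendsto_eVariationOn_Icc_zero_left
    (x := x) ((hγ x hx).mono inter_subset_left)
  have h2 := hb.tendsto_eVariationOn_Icc_zero_right x
    ((hγ x hx).mono inter_subset_left)
  have h1' := (ENNReal.tendsto_toReal ENNReal.zero_ne_top).comp h1
  have h2' := (ENNReal.tendsto_toReal ENNReal.zero_ne_top).comp h2
  simp only [ENNReal.toReal_zero] at h1' h2'
  have h3 := h1'.add h2'
  rw [ContinuousWithinAt, tendsto_iff_dist_tendsto_zero]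
  refine squeeze_zero' (Eventually.of_forall fun _ => dist_nonneg) ?_ (by simpa using h3)
  filter_upwards [self_mem_nhdsWithin] with y hy
  rcases le_total y x with hyx | hxy
  · rw [hadd hy.1 hyx hx.2, Real.dist_eq, inter_eq_right.2 (Icc_subset_Icc hy.1 hx.2),
      abs_of_nonpos (by linarith [ENNReal.toReal_nonneg (a := eVariationOn γ (Icc y x))])]
    linarith [ENNReal.toReal_nonneg (a := eVariationOn γ (Icc 0 1 ∩ Icc x y))]
  · rw [hadd hx.1 hxy hy.2, Real.dist_eq, inter_eq_right.2 (Icc_subset_Icc hx.1 hy.2),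
      abs_of_nonneg (by linarith [ENNReal.toReal_nonneg (a := eVariationOn γ (Icc x y))])]
    linarith [ENNReal.toReal_nonneg (a := eVariationOn γ (Icc 0 1 ∩ Icc y x))]

/-- Reparametrization by arclength, rescaled to `[0,1]`, with `L` the total length. It makes a
family of uniform curves equi-Lipschitz and turns the cigar radii into explicit functions of time.
-/
theorem IsUniformCurve.exists_isSteadyCurve {A : ℝ} (hA : 1 ≤ A) {Ω : Set ℂ} {γ : ℝ → ℂ}
    (h : IsUniformCurve A Ω γ) : ∃ L β, IsSteadyCurve A Ω (γ 0) (γ 1) L β := by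
  have hA0 : 0 < A := by linarith
  have hfin : eVariationOn γ (Icc 0 1) ≠ ∞ := ne_top_of_le_ne_top ENNReal.ofReal_ne_top h.length_le
  have hle : ∀ {x y : ℝ}, 0 ≤ x → y ≤ 1 → eVariationOn γ (Icc x y) ≠ ∞ := fun hx hy =>
    ne_top_of_le_ne_top hfin (eVariationOn.mono γ (Icc_subset_Icc hx hy))
  set V : ℝ → ℝ := fun t => (eVariationOn γ (Icc 0 t)).toReal with hV
  have hadd : ∀ {x y : ℝ}, 0 ≤ x → x ≤ y → y ≤ 1 →
      (eVariationOn γ (Icc x y)).toReal = V y - V x := by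
    intro x y hx hxy hy
    have := eVariationOn.Icc_add_Icc γ (s := univ) hx hxy (mem_univ x)
    simp only [univ_inter] at this
    simp only [hV]
    rw [← this, ENNReal.toReal_add (hle le_rfl (hxy.trans hy)) (hle hx hy)]
    ring
  have hV0 : V 0 = 0 := by simp [hV]
  have hcont : ContinuousOn V (Icc 0 1) := continuousOn_eVariationOn_Icc_zero h.continuousOn hfin
  have hdist : ∀ {x y : ℝ}, 0 ≤ x → x ≤ y → y ≤ 1 → dist (γ x) (γ y) ≤ V y - V x := by
    intro x y hx hxy hy
    rw [← hadd hx hxy hy, dist_edist]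
    exact ENNReal.toReal_mono (hle hx hy)
      (eVariationOn.edist_le γ (left_mem_Icc.2 hxy) (right_mem_Icc.2 hxy))
  have hdist' : ∀ x ∈ Icc (0 : ℝ) 1, ∀ y ∈ Icc (0 : ℝ) 1,
      dist (γ x) (γ y) ≤ |V x - V y| := by
    intro x hx y hy
    rcases le_total x y with hxy | hxy
    · exact (hdist hx.1 hxy hy.2).trans (by rw [abs_sub_comm]; exact le_abs_self _)
    · rw [dist_comm]
      exact (hdist hy.1 hxy hx.2).trans (le_abs_self _)
  set L := V 1 with hL
  have hL0 : 0 ≤ L := ENNReal.toReal_nonneg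
  have hex : ∀ s ∈ Icc (0 : ℝ) 1, ∃ t ∈ Icc (0 : ℝ) 1, V t = L * s := by
    intro s hs
    have hmem : L * s ∈ Icc (V 0) (V 1) := by
      rw [hV0]
      exact ⟨mul_nonneg hL0 hs.1, mul_le_of_le_one_right hL0 hs.2⟩
    exact intermediate_value_Icc zero_le_one hcont hmem
  -- `τ` is an arbitrary right inverse of the normalized arclength, perhaps discontinuous and with
  -- `τ 0 ≠ 0`. This is harmless, since `γ` is constant wherever `V` is, by `hdist'`.
  choose! τ hτ hVτ using hex
  have h0 : (0 : ℝ) ∈ Icc (0 : ℝ) 1 := by simp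
  have h1 : (1 : ℝ) ∈ Icc (0 : ℝ) 1 := by simp
  refine ⟨L, fun s => γ (τ s), hL0, ?_, ?_, ?_, ?_, ?_⟩
  · exact ENNReal.toReal_le_of_le_ofReal (by positivity) h.length_le
  · have := hdist' _ (hτ 0 h0) 0 h0
    rw [hVτ 0 h0, hV0] at this
    simpa using this
  · have := hdist' _ (hτ 1 h1) 1 h1
    rw [hVτ 1 h1, ← hL] at this
    simpa using this
  · intro s hs t ht
    refine (hdist' _ (hτ s hs) _ (hτ t ht)).trans_eq ?_
    rw [hVτ s hs, hVτ t ht, ← mul_sub, abs_mul, abs_of_nonneg hL0]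
  · intro s hs
    refine Subset.trans ?_ h.cigar_subset
    intro z hz
    refine mem_iUnion₂.2 ⟨τ s, hτ s hs, ?_⟩
    rw [Metric.mem_eball, edist_dist, ← ENNReal.ofReal_inv_of_pos hA0,
      ← ENNReal.ofReal_toReal (hle le_rfl (hτ s hs).2),
      ← ENNReal.ofReal_toReal (hle (hτ s hs).1 le_rfl), ← ENNReal.ofReal_min,
      ← ENNReal.ofReal_mul (by positivity), hadd (hτ s hs).1 (hτ s hs).2 le_rfl]
    have e1 : (eVariationOn γ (Icc 0 (τ s))).toReal = L * s := hVτ s hs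
    rw [e1, hVτ s hs, ← hL, show L - L * s = L * (1 - s) by ring,
      ← mul_min_of_nonneg _ _ hL0]
    rw [mem_ball] at hz
    exact (ENNReal.ofReal_lt_ofReal_iff (dist_nonneg.trans_lt hz)).2 hz

theorem IsUniformDomain.exists_isSteadyCurve {A : ℝ} (hA : 1 ≤ A) {Ω : Set ℂ}
    (h : IsUniformDomain A Ω) {a b : ℂ} (ha : a ∈ Ω) (hb : b ∈ Ω) :
    ∃ L β, IsSteadyCurve A Ω a b L β := by
  obtain ⟨γ, rfl, rfl, hγ⟩ := h.2 a ha b hb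
  exact hγ.exists_isSteadyCurve hA

namespace IsSteadyCurve

variable {A L : ℝ} {Ω : Set ℂ} {a b : ℂ} {β : ℝ → ℂ}

theorem lipschitzOnWith (h : IsSteadyCurve A Ω a b L β) :
    LipschitzOnWith L.toNNReal β (Icc 0 1) :=
  LipschitzOnWith.of_dist_le_mul fun x hx y hy => by
    rw [Real.coe_toNNReal _ h.length_nonneg, Real.dist_eq]
    exact h.dist_le x hx y hy

theorem mem (h : IsSteadyCurve A Ω a b L β) (hA : 1 ≤ A) (ha : a ∈ Ω) (hb : b ∈ Ω) :
    ∀ t ∈ Icc (0 : ℝ) 1, β t ∈ Ω := by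
  intro t ht
  rcases eq_or_lt_of_le h.length_nonneg with hL | hL
  · have := h.dist_le t ht 0 (by simp)
    rw [← hL, zero_mul, dist_le_zero, h.zero] at this
    rwa [this]
  rcases eq_or_lt_of_le ht.1 with h0 | h0
  · rwa [← h0, h.zero]
  rcases eq_or_lt_of_le ht.2 with h1 | h1
  · rwa [h1, h.one]
  refine h.ball_subset t ht (mem_ball_self ?_)
  have : 0 < min t (1 - t) := lt_min h0 (by linarith)
  positivity

theorem eVariationOn_le (h : IsSteadyCurve A Ω a b L β) {s t : ℝ} (hs : 0 ≤ s)
    (ht : t ≤ 1) : eVariationOn β (Icc s t) ≤ ENNReal.ofReal (L * (t - s)) := by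
  have h1 := (h.lipschitzOnWith.mono (Icc_subset_Icc hs ht)).comp_eVariationOn_le
    (f := β) (g := id) (s := Icc s t) (fun x hx => hx)
  rw [eVariationOn_id_Icc, Function.comp_id] at h1
  refine h1.trans_eq ?_
  rw [ENNReal.ofReal_mul h.length_nonneg]
  rfl

/-- The constant `L` only bounds the length from above, and so do `L * t` and `L * (1 - t)` for the
two subarcs. Hence the cigar lies in the union of the balls of the steady curve. -/
theorem isUniformCurve (h : IsSteadyCurve A Ω a b L β) (hA : 1 ≤ A) (ha : a ∈ Ω) (hb : b ∈ Ω) :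
    IsUniformCurve A Ω β := by
  refine ⟨h.lipschitzOnWith.continuousOn, h.mem hA ha hb, ?_, ?_⟩
  · rw [h.zero, h.one]
    refine (h.eVariationOn_le le_rfl le_rfl).trans (ENNReal.ofReal_le_ofReal ?_)
    simpa using h.length_le
  · refine iUnion₂_subset fun t ht => ?_
    refine Subset.trans ?_ (h.ball_subset t ht)
    have hA0 : 0 < A := by linarith
    have hmin : 0 ≤ min t (1 - t) := le_min ht.1 (by linarith [ht.2])
    have hr : 0 ≤ A⁻¹ * (L * min t (1 - t)) :=
      mul_nonneg (by positivity) (mul_nonneg h.length_nonneg hmin)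
    rw [← Metric.eball_ofReal]
    refine Metric.eball_subset_eball ?_
    rw [← ENNReal.ofReal_inv_of_pos hA0, ENNReal.ofReal_mul (by positivity)]
    gcongr
    rw [mul_min_of_nonneg _ _ h.length_nonneg, ENNReal.ofReal_min]
    refine min_le_min ?_ (h.eVariationOn_le ht.1 le_rfl)
    simpa using h.eVariationOn_le le_rfl ht.2

end IsSteadyCurve

/-! ### Limits of curves and uniformity of the kernel -/

theorem Ultrafilter.exists_tendsto_of_eventually_mem {X ι : Type*} [TopologicalSpace X]
    (u : Ultrafilter ι) {K : Set X} (hK : IsCompact K) {f : ι → X} (h : ∀ᶠ n in u, f n ∈ K) :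
    ∃ x ∈ K, Tendsto f u (𝓝 x) :=
  hK.ultrafilter_le_nhds (u.map f) (le_principal_iff.2 h)

theorem exists_ultrafilter_of_frequently {p : ℕ → Prop} (h : ∃ᶠ n in atTop, p n) :
    ∃ u : Ultrafilter ℕ, (u : Filter ℕ) ≤ atTop ∧ ∀ᶠ n in u, p n := by
  have : NeBot (atTop ⊓ 𝓟 {n | p n}) := frequently_mem_iff_neBot.1 h
  obtain ⟨u, hu⟩ := Ultrafilter.exists_le (atTop ⊓ 𝓟 {n | p n})
  exact ⟨u, hu.trans inf_le_left, le_principal_iff.1 (hu.trans inf_le_right)⟩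

/-- Any two points of `Ω` can be joined by a steady curve with constant `A`. -/
def HasSteadyCurves (A : ℝ) (Ω : Set ℂ) : Prop :=
  ∀ a ∈ Ω, ∀ b ∈ Ω, ∃ L β, IsSteadyCurve A Ω a b L β

namespace PlanarKernelLimit

variable {Ωs : ℕ → Set ℂ} {Ω : Set ℂ} {A : ℝ}

theorem mem_frequentInterior_of_tendsto {u : Ultrafilter ℕ} (hu : (u : Filter ℕ) ≤ atTop)
    {x : ℕ → ℂ} {r : ℕ → ℝ} {y z : ℂ} {ρ : ℝ} (hx : Tendsto x u (𝓝 y))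
    (hr : Tendsto r u (𝓝 ρ)) (hb : ∀ᶠ n in u, ball (x n) (r n) ⊆ Ωs n) (hz : dist z y < ρ) :
    z ∈ frequentInterior Ωs := by
  -- One third of the gap each for the radius of the ball around `z`, the displacement of the centre
  -- and the loss of radius.
  set δ := (ρ - dist z y) / 3 with hδ
  have hδ0 : 0 < δ := by rw [hδ]; linarith
  refine ⟨δ, hδ0, Frequently.filter_mono (Eventually.frequently ?_) hu⟩
  filter_upwards [hb, hx (ball_mem_nhds y hδ0), hr (lt_mem_nhds (show ρ - δ < ρ by linarith))]
    with n h1 h2 h3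
  refine Subset.trans (fun w hw => ?_) h1
  rw [mem_ball] at hw ⊢
  have h2' : dist (x n) y < δ := h2
  have h3' : ρ - δ < r n := h3
  have := dist_triangle4 w z y (x n)
  rw [dist_comm y (x n)] at this
  linarith

/-- The point `a` is only assumed to lie in infinitely many terms with a fixed ball, and the
ultrafilter is chosen to see those terms. The limit curve then ties `a` to `b ∈ Ω`, so membership of
`a` in `Ω` is a conclusion. -/
theorem exists_isSteadyCurve_of_mem_frequentInterior (hA : 1 ≤ A) (h : PlanarKernelLimit Ωs Ω)
    (hs : ∀ n, HasSteadyCurves A (Ωs n)) {a b : ℂ} (ha : a ∈ frequentInterior Ωs) (hb : b ∈ Ω) :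
    a ∈ Ω ∧ ∃ L β, IsSteadyCurve A Ω a b L β := by
  obtain ⟨ε, hε, hfr⟩ := ha
  obtain ⟨δ, hδ, hev⟩ := h.eventually_ball b hb
  obtain ⟨u, hu, hmem⟩ := exists_ultrafilter_of_frequently (hfr.and_eventually hev)
  -- The implication is placed under the quantifiers so that the choice is defined for all `n`; the
  -- values at bad indices are irrelevant to `u`.
  have hex : ∀ n, ∃ L β, ball a ε ⊆ Ωs n ∧ ball b δ ⊆ Ωs n → IsSteadyCurve A (Ωs n) a b L β := by
    intro n
    by_cases hn : ball a ε ⊆ Ωs n ∧ ball b δ ⊆ Ωs n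
    · obtain ⟨L, β, hβ⟩ := hs n a (hn.1 (mem_ball_self hε)) b (hn.2 (mem_ball_self hδ))
      exact ⟨L, β, fun _ => hβ⟩
    · exact ⟨0, 0, fun h' => absurd h' hn⟩
  choose L β hβ using hex
  have hβ' : ∀ᶠ n in u, IsSteadyCurve A (Ωs n) a b (L n) (β n) := hmem.mono fun n hn => hβ n hn
  obtain ⟨L', hL', hLlim⟩ := u.exists_tendsto_of_eventually_mem (f := L)
    (isCompact_Icc (a := (0 : ℝ)) (b := A * dist a b))
    (hβ'.mono fun n hn => ⟨hn.length_nonneg, hn.length_le⟩)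
  have hlim : ∀ t : ℝ, ∃ x, t ∈ Icc (0 : ℝ) 1 → Tendsto (fun n => β n t) u (𝓝 x) := by
    intro t
    by_cases ht : t ∈ Icc (0 : ℝ) 1
    · obtain ⟨x, -, hx⟩ := u.exists_tendsto_of_eventually_mem (f := fun n => β n t)
        (isCompact_closedBall a (A * dist a b)) (hβ'.mono fun n hn => by
          have h1 := hn.dist_le t ht 0 (by simp)
          rw [hn.zero, sub_zero, abs_of_nonneg ht.1] at h1
          rw [mem_closedBall]
          exact (h1.trans (mul_le_of_le_one_right hn.length_nonneg ht.2)).trans hn.length_le)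
      exact ⟨x, fun _ => hx⟩
    · exact ⟨0, fun h' => absurd h' ht⟩
  choose η hη using hlim
  have hη0 : η 0 = a := tendsto_nhds_unique (hη 0 (by simp))
    (tendsto_const_nhds.congr' (hβ'.mono fun n hn => hn.zero.symm))
  have hη1 : η 1 = b := tendsto_nhds_unique (hη 1 (by simp))
    (tendsto_const_nhds.congr' (hβ'.mono fun n hn => hn.one.symm))
  have hdist : ∀ s ∈ Icc (0 : ℝ) 1, ∀ t ∈ Icc (0 : ℝ) 1, dist (η s) (η t) ≤ L' * |s - t| :=
    fun s hs t ht => le_of_tendsto_of_tendsto ((hη s hs).dist (hη t ht)) (hLlim.mul_const _)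
      (hβ'.mono fun n hn => hn.dist_le s hs t ht)
  have hball : ∀ t ∈ Icc (0 : ℝ) 1,
      ball (η t) (A⁻¹ * (L' * min t (1 - t))) ⊆ frequentInterior Ωs := by
    intro t ht z hz
    exact mem_frequentInterior_of_tendsto hu (hη t ht) ((hLlim.mul_const _).const_mul _)
      (hβ'.mono fun n hn => hn.ball_subset t ht) hz
  have hsteady : IsSteadyCurve A (frequentInterior Ωs) a b L' η :=
    ⟨hL'.1, hL'.2, hη0, hη1, hdist, hball⟩
  have haE : a ∈ frequentInterior Ωs := ⟨ε, hε, hfr⟩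
  have hbE := h.subset_frequentInterior hb
  have hcurve : IsPreconnected (η '' Icc 0 1) :=
    isPreconnected_Icc.image _ hsteady.lipschitzOnWith.continuousOn
  -- The limit curve and, below, each of its balls are connected subsets of `frequentInterior Ωs`
  -- meeting `Ω`.
  have hsub : η '' Icc 0 1 ⊆ Ω := by
    refine h.isPreconnected_subset hcurve ?_ ⟨b, ⟨1, by simp, hη1⟩, hb⟩
    rintro _ ⟨t, ht, rfl⟩
    exact hsteady.mem hA haE hbE t ht
  refine ⟨hη0 ▸ hsub ⟨0, by simp, rfl⟩, L', η, hL'.1, hL'.2, hη0, hη1, hdist, fun t ht => ?_⟩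
  rcases le_or_gt (A⁻¹ * (L' * min t (1 - t))) 0 with hr | hr
  · rw [ball_eq_empty.2 hr]
    exact empty_subset _
  · exact h.isPreconnected_subset (convex_ball _ _).isPreconnected (hball t ht)
      ⟨η t, mem_ball_self hr, hsub ⟨t, ht, rfl⟩⟩

theorem nonempty (h : PlanarKernelLimit Ωs Ω) : Ω.Nonempty := by
  obtain ⟨R, hR, hΩ, -⟩ := h.exists_radius
  exact ⟨(R : ℂ), hΩ _ (by simp [abs_of_pos hR])⟩

theorem frequentInterior_eq (hA : 1 ≤ A) (h : PlanarKernelLimit Ωs Ω)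
    (hs : ∀ n, HasSteadyCurves A (Ωs n)) : frequentInterior Ωs = Ω := by
  obtain ⟨b, hb⟩ := h.nonempty
  exact Subset.antisymm
    (fun a ha => (h.exists_isSteadyCurve_of_mem_frequentInterior hA hs ha hb).1)
    h.subset_frequentInterior

theorem hasSteadyCurves (hA : 1 ≤ A) (h : PlanarKernelLimit Ωs Ω)
    (hs : ∀ n, HasSteadyCurves A (Ωs n)) : HasSteadyCurves A Ω := fun _ ha _ hb =>
  (h.exists_isSteadyCurve_of_mem_frequentInterior hA hs (h.subset_frequentInterior ha) hb).2

theorem isUniformDomain (hA : 1 ≤ A) (h : PlanarKernelLimit Ωs Ω)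
    (hs : ∀ n, HasSteadyCurves A (Ωs n)) : IsUniformDomain A Ω := by
  have hc := h.hasSteadyCurves hA hs
  refine ⟨⟨h.isOpen, h.nonempty, isPreconnected_of_forall_pair fun a ha b hb => ?_⟩,
    fun a ha b hb => ?_⟩
  · obtain ⟨L, β, hβ⟩ := hc a ha b hb
    refine ⟨β '' Icc 0 1, ?_, ⟨0, by simp, hβ.zero⟩, ⟨1, by simp, hβ.one⟩,
      isPreconnected_Icc.image _ hβ.lipschitzOnWith.continuousOn⟩
    rintro _ ⟨t, ht, rfl⟩
    exact hβ.mem hA ha hb t ht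
  · obtain ⟨L, β, hβ⟩ := hc a ha b hb
    exact ⟨β, hβ.zero, hβ.one, hβ.isUniformCurve hA ha hb⟩

/-- Interior points of the complement of the limit are uniformly far from the terms of the
sequence. -/
theorem eventually_disjoint_ball (hA : 1 ≤ A) (h : PlanarKernelLimit Ωs Ω)
    (hs : ∀ n, HasSteadyCurves A (Ωs n)) {z : ℂ} {s : ℝ} (hs0 : 0 < s)
    (hdisj : Disjoint (ball z s) Ω) : ∀ᶠ n in atTop, Disjoint (ball z (s / 2)) (Ωs n) := by
  have hA0 : 0 < A := by linarith
  by_contra hcon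
  obtain ⟨b, hb⟩ := h.nonempty
  have hbz : s ≤ dist b z := by
    by_contra! hlt
    exact disjoint_left.1 hdisj hlt hb
  obtain ⟨δ, hδ, hev⟩ := h.eventually_ball b hb
  have hfr : ∃ᶠ n in atTop, ¬ Disjoint (ball z (s / 2)) (Ωs n) ∧ ball b δ ⊆ Ωs n :=
    Frequently.and_eventually (not_eventually.1 hcon) hev
  obtain ⟨u, hu, hmem⟩ := exists_ultrafilter_of_frequently hfr
  have hex : ∀ n, ∃ w, (¬ Disjoint (ball z (s / 2)) (Ωs n) ∧ ball b δ ⊆ Ωs n) →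
      dist w z = 3 / 4 * s ∧ ball w (A⁻¹ * (s / 4)) ⊆ Ωs n := by
    intro n
    by_cases hn : ¬ Disjoint (ball z (s / 2)) (Ωs n) ∧ ball b δ ⊆ Ωs n
    swap
    · exact ⟨0, fun h' => absurd h' hn⟩
    obtain ⟨a, haz, haΩ⟩ := not_disjoint_iff.1 hn.1
    rw [mem_ball] at haz
    obtain ⟨L, β, hβ⟩ := hs n a haΩ b (hn.2 (mem_ball_self hδ))
    have hcont : ContinuousOn (fun t => dist (β t) z) (Icc 0 1) :=
      (continuous_id.dist continuous_const).comp_continuousOn hβ.lipschitzOnWith.continuousOn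
    -- The curve starts within `s / 2` of `z` and ends at distance at least `s`. Where it crosses
    -- radius `3 / 4 * s`, both subarcs have length at least `s / 4`, so a ball of radius `A⁻¹ * (s
    -- / 4)` lies in the term. Limits of such centres lie in `Ω` but within `s` of `z`.
    obtain ⟨t, ht, hts⟩ := intermediate_value_Icc zero_le_one hcont
      (show 3 / 4 * s ∈ Icc _ _ by
        rw [hβ.zero, hβ.one]; exact ⟨by linarith, by linarith⟩)
    refine ⟨β t, fun _ => ⟨hts, Subset.trans (ball_subset_ball ?_) (hβ.ball_subset t ht)⟩⟩
    have hts' : dist (β t) z = 3 / 4 * s := hts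
    gcongr
    rw [mul_min_of_nonneg _ _ hβ.length_nonneg]
    refine le_min ?_ ?_
    · have h1 := hβ.dist_le t ht 0 (by simp)
      rw [hβ.zero, sub_zero, abs_of_nonneg ht.1] at h1
      linarith [dist_triangle (β t) a z]
    · have h1 := hβ.dist_le 1 (by simp) t ht
      rw [hβ.one, abs_of_nonneg (by linarith [ht.2])] at h1
      linarith [dist_triangle b (β t) z]
  choose w hw using hex
  obtain ⟨w', hw', hlim⟩ := u.exists_tendsto_of_eventually_mem (f := w)
    (isCompact_closedBall z (3 / 4 * s)) (hmem.mono fun n hn => (hw n hn).1.le)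
  have hwE : w' ∈ frequentInterior Ωs :=
    mem_frequentInterior_of_tendsto hu hlim (tendsto_const_nhds (x := A⁻¹ * (s / 4)))
      (hmem.mono fun n hn => (hw n hn).2) (by rw [dist_self]; positivity)
  rw [h.frequentInterior_eq hA hs] at hwE
  refine disjoint_left.1 hdisj ?_ hwE
  rw [mem_closedBall] at hw'
  rw [mem_ball]
  linarith

end PlanarKernelLimit

/-! ### Continuous logarithms -/

/-- A branch of `ζ ↦ log (ζ - p)` on the punctured closed disc with centre `c` that has `p` on its
boundary circle. -/
noncomputable def discLog (p c ζ : ℂ) : ℂ :=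
  Complex.log ((ζ - p) / (c - p)) + Complex.log (c - p)

/-- The quotient `w` is a nonzero point of the closed unit disc about `1`, and `‖w - 1‖ ≤ 1` reads
`‖w‖ ^ 2 ≤ 2 * w.re`. -/
theorem div_sub_mem_slitPlane {p c ζ : ℂ} (hc : c ≠ p) (hζ : dist ζ c ≤ dist c p) (hp : ζ ≠ p) :
    (ζ - p) / (c - p) ∈ Complex.slitPlane := by
  have hcp : c - p ≠ 0 := sub_ne_zero.2 hc
  have hζp : ζ - p ≠ 0 := sub_ne_zero.2 hp
  set w := (ζ - p) / (c - p) with hw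
  have hw0 : w ≠ 0 := div_ne_zero hζp hcp
  have hw1 : ‖w - 1‖ ≤ 1 := by
    have : w - 1 = (ζ - c) / (c - p) := by rw [hw]; field_simp; ring
    rw [this, norm_div, div_le_one (norm_pos_iff.2 hcp), ← dist_eq_norm, ← dist_eq_norm]
    exact hζ
  refine Or.inl ?_
  have h1 : ‖w - 1‖ ^ 2 ≤ 1 := by nlinarith [norm_nonneg (w - 1)]
  have h2 : 0 < Complex.normSq w := Complex.normSq_pos.2 hw0
  rw [← Complex.normSq_eq_norm_sq, Complex.normSq_apply] at h1
  rw [Complex.normSq_apply] at h2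
  simp only [Complex.sub_re, Complex.sub_im, Complex.one_re, Complex.one_im] at h1
  nlinarith

theorem exp_discLog {p c ζ : ℂ} (hc : c ≠ p) (hp : ζ ≠ p) :
    Complex.exp (discLog p c ζ) = ζ - p := by
  have hcp : c - p ≠ 0 := sub_ne_zero.2 hc
  have hζp : ζ - p ≠ 0 := sub_ne_zero.2 hp
  rw [discLog, Complex.exp_add, Complex.exp_log (div_ne_zero hζp hcp), Complex.exp_log hcp]
  field_simp

theorem continuousOn_discLog {p c : ℂ} (hc : c ≠ p) :
    ContinuousOn (discLog p c) (closedBall c (dist c p) \ {p}) := by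
  unfold discLog
  refine ContinuousOn.add (ContinuousOn.clog (by fun_prop) ?_) continuousOn_const
  rintro ζ ⟨hζ, hp⟩
  exact div_sub_mem_slitPlane hc hζ hp

theorem eqOn_of_exp_eqOn {X : Type*} [TopologicalSpace X] {s : Set X} {f g : X → ℂ}
    (hs : IsPreconnected s) (hf : ContinuousOn f s) (hg : ContinuousOn g s)
    (h : ∀ x ∈ s, Complex.exp (f x) = Complex.exp (g x)) {x₀ : X} (hx₀ : x₀ ∈ s)
    (h₀ : f x₀ = g x₀) : EqOn f g s :=
  Complex.isCoveringMap_exp.eqOn_of_comp_eqOn hs hf hg (fun x hx => Subtype.ext (h x hx)) hx₀ h₀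

theorem sub_eqOn_const_of_exp_eqOn {X : Type*} [TopologicalSpace X] {s : Set X} {f g : X → ℂ}
    (hs : IsPreconnected s) (hf : ContinuousOn f s) (hg : ContinuousOn g s)
    (h : ∀ x ∈ s, Complex.exp (f x) = Complex.exp (g x)) {x y : X} (hx : x ∈ s) (hy : y ∈ s) :
    f x - g x = f y - g y := by
  have hxe : Complex.exp (f x - g x) = 1 := by
    rw [Complex.exp_sub, h x hx, div_self (Complex.exp_ne_zero _)]
  have := eqOn_of_exp_eqOn (g := fun w => g w + (f x - g x)) hs hf (hg.add continuousOn_const)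
    (fun w hw => by rw [Complex.exp_add, hxe, mul_one, h w hw]) hx (by ring)
  have h2 := this hy
  simp only at h2
  rw [h2]
  ring

/-- By uniqueness of lifts, the logarithm along the circle is its initial value plus `θ * I`, which
is not `2π`-periodic. -/
theorem not_exists_log_on_sphere {z : ℂ} {ρ : ℝ} (hρ : 0 < ρ) :
    ¬ ∃ k : ℂ → ℂ, ContinuousOn k (sphere z ρ) ∧ ∀ ζ ∈ sphere z ρ, Complex.exp (k ζ) = ζ - z := by
  rintro ⟨k, hk, hexp⟩
  have hmem : ∀ θ : ℝ, circleMap z ρ θ ∈ sphere z ρ := circleMap_mem_sphere z hρ.le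
  have hf : Continuous fun θ : ℝ => k (circleMap z ρ θ) :=
    hk.comp_continuous (continuous_circleMap z ρ) hmem
  have hg : Continuous fun θ : ℝ => k (circleMap z ρ 0) + θ * Complex.I := by fun_prop
  have h := eqOn_of_exp_eqOn isPreconnected_univ hf.continuousOn hg.continuousOn
    (fun θ _ => by
      rw [hexp _ (hmem θ), Complex.exp_add, hexp _ (hmem 0)]
      simp [circleMap]) (mem_univ 0) (by simp)
  have h2 := h (mem_univ (2 * Real.pi))
  have hper : circleMap z ρ (2 * Real.pi) = circleMap z ρ 0 := by
    simp [circleMap]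
  simp only [hper] at h2
  have h3 : ((2 * Real.pi : ℝ) : ℂ) * Complex.I = 0 := by
    have := h2.symm
    rwa [add_eq_left] at this
  have := Real.pi_ne_zero
  simp [this] at h3

/-! ### Hole discs of a circle domain -/

/-- The open disc `ball c r` is a component of the exterior of `Ω`. -/
structure IsHoleDisc (Ω : Set ℂ) (c : ℂ) (r : ℝ) : Prop where
  pos : 0 < r
  disjoint : Disjoint (ball c r) Ω
  sphere_subset : sphere c r ⊆ closure Ω

/-- The open set `Ω` misses its frontier, hence the circle; being connected and containing far
points, it stays outside. -/
theorem isHoleDisc_of_sphere_subset_frontier {Ω : Set ℂ} (hΩ : IsOpen Ω)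
    (hconn : IsPreconnected Ω) {R : ℝ} (hR : ∀ z : ℂ, R ≤ ‖z‖ → z ∈ Ω) {c : ℂ} {r : ℝ} (hr : 0 < r)
    (hs : sphere c r ⊆ frontier Ω) : IsHoleDisc Ω c r := by
  refine ⟨hr, ?_, hs.trans frontier_subset_closure⟩
  have hdisj : ∀ z ∈ Ω, dist z c ≠ r := fun z hz hzr => by
    have := hs (mem_sphere.2 hzr)
    rw [hΩ.frontier_eq] at this
    exact this.2 hz
  have hsub : Ω ⊆ (closedBall c r)ᶜ := by
    refine hconn.subset_left_of_subset_union isClosed_closedBall.isOpen_compl isOpen_ball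
      (disjoint_compl_left_iff_subset.2 ball_subset_closedBall) (fun z hz => ?_) ?_
    · rcases lt_or_gt_of_ne (hdisj z hz) with h | h
      · exact Or.inr h
      · exact Or.inl fun h' => absurd (mem_closedBall.1 h') (not_le.2 h)
    · set x : ℝ := |R| + ‖c‖ + r + 1
      have hx : ‖(x : ℂ)‖ = x := by
        rw [Complex.norm_real, Real.norm_of_nonneg (by positivity)]
      refine ⟨(x : ℂ), hR _ ?_, fun h' => ?_⟩
      · rw [hx]
        have : 0 ≤ ‖c‖ := norm_nonneg c
        linarith [le_abs_self R, show x = |R| + ‖c‖ + r + 1 from rfl]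
      · rw [mem_closedBall, dist_eq_norm] at h'
        have h1 := norm_sub_norm_le (x : ℂ) c
        rw [hx] at h1
        linarith [abs_nonneg R, show x = |R| + ‖c‖ + r + 1 from rfl]
  exact (disjoint_left.2 fun z hz hzΩ => hsub hzΩ (ball_subset_closedBall hz))

/-- In a compact Hausdorff space components are intersections of clopen sets, and compactness
selects one of these inside `U`. -/
theorem exists_isClopen_subset_of_connectedComponent_subset {X : Type*} [TopologicalSpace X]
    [T2Space X] [CompactSpace X] {x : X} {U : Set X} (hU : IsOpen U)
    (h : connectedComponent x ⊆ U) : ∃ s : Set X, IsClopen s ∧ x ∈ s ∧ s ⊆ U := by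
  rw [connectedComponent_eq_iInter_isClopen] at h
  have : Nonempty {s : Set X // IsClopen s ∧ x ∈ s} := ⟨⟨univ, isClopen_univ, mem_univ x⟩⟩
  have hdir : Directed (· ⊇ ·) fun s : {s : Set X // IsClopen s ∧ x ∈ s} => s.val := by
    rintro ⟨s, hs, hxs⟩ ⟨t, ht, hxt⟩
    exact ⟨⟨s ∩ t, hs.inter ht, ⟨hxs, hxt⟩⟩, inter_subset_left, inter_subset_right⟩
  obtain ⟨s, hs⟩ := exists_subset_nhds_of_compactSpace hdir (fun s => s.2.1.1)
    (fun y hy => hU.mem_nhds (h hy))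
  exact ⟨s, s.2.1, s.2.2, hs⟩

/-- Finitely many clopen sets carrying a logarithm cover the space, and logarithms on clopen sets
can be glued without any compatibility. -/
theorem exists_continuous_log_of_components {X : Type*} [TopologicalSpace X]
    [T2Space X] [CompactSpace X] {f : X → ℂ}
    (h : ∀ x, ∃ U : Set X, IsOpen U ∧ connectedComponent x ⊆ U ∧
      ∃ k : X → ℂ, ContinuousOn k U ∧ ∀ y ∈ U, Complex.exp (k y) = f y) :
    ∃ k : X → ℂ, Continuous k ∧ ∀ y, Complex.exp (k y) = f y := by
  classical
  have hall : ∃ Z : Set X, IsClopen Z ∧ univ ⊆ Z ∧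
      ∃ k : X → ℂ, ContinuousOn k Z ∧ ∀ y ∈ Z, Complex.exp (k y) = f y := by
    refine isCompact_univ.induction_on (p := fun s => ∃ Z : Set X, IsClopen Z ∧ s ⊆ Z ∧
      ∃ k : X → ℂ, ContinuousOn k Z ∧ ∀ y ∈ Z, Complex.exp (k y) = f y) ?_ ?_ ?_ ?_
    · exact ⟨∅, isClopen_empty, subset_rfl, 0, continuousOn_empty _, by simp⟩
    · rintro s t hst ⟨Z, hZ, htZ, hk⟩
      exact ⟨Z, hZ, hst.trans htZ, hk⟩
    · rintro s t ⟨Z, hZ, hsZ, k, hk, hkf⟩ ⟨Z', hZ', htZ, k', hk', hkf'⟩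
      refine ⟨Z ∪ Z', hZ.union hZ', union_subset_union hsZ htZ, Z.piecewise k k', ?_, ?_⟩
      · refine ContinuousOn.piecewise ?_ (hk.mono ?_) (hk'.mono ?_)
        · rw [hZ.frontier_eq]; simp
        · rw [hZ.isClosed.closure_eq]; exact inter_subset_right
        · rw [hZ.compl.isClosed.closure_eq]
          rintro y ⟨hy | hy, hyn⟩
          · exact absurd hy hyn
          · exact hy
      · intro y hy
        by_cases hyZ : y ∈ Z
        · rw [piecewise_eq_of_mem _ _ _ hyZ, hkf y hyZ]
        · rw [piecewise_eq_of_notMem _ _ _ hyZ, hkf' y (hy.resolve_left hyZ)]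
    · intro x _
      obtain ⟨U, hU, hxU, k, hk, hkf⟩ := h x
      obtain ⟨Z, hZ, hxZ, hZU⟩ := exists_isClopen_subset_of_connectedComponent_subset hU hxU
      exact ⟨Z, mem_nhdsWithin_of_mem_nhds (hZ.isOpen.mem_nhds hxZ), Z, hZ, subset_rfl, k,
        hk.mono hZU, fun y hy => hkf y (hZU hy)⟩
  obtain ⟨Z, -, hZ, k, hk, hkf⟩ := hall
  exact ⟨k, by rw [← continuousOn_univ]; exact hk.mono hZ, fun y => hkf y (hZ (mem_univ y))⟩

/-- The planar form of the boundary condition in the definition of a circle domain. -/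
def HasCircularBoundary (Ω : Set ℂ) : Prop :=
  ∀ p ∈ frontier Ω, (∃ (c : ℂ) (r : ℝ), 0 < r ∧
    connectedComponentIn (frontier Ω) p = sphere c r) ∨ connectedComponentIn (frontier Ω) p = {p}

/-- If `Ω` is a neighbourhood of infinity and `z ∉ Ω`, then `y ↦ y - z` has no continuous logarithm
on the boundary of `Ω`. -/
theorem not_exists_log_on_frontier {Ω : Set ℂ} {R : ℝ}
    (hR : ∀ z : ℂ, R ≤ ‖z‖ → z ∈ Ω) {z : ℂ} (hz : z ∉ Ω) :
    ¬ ∃ k : frontier Ω → ℂ, Continuous k ∧ ∀ y, Complex.exp (k y) = (y : ℂ) - z := by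
  classical
  rintro ⟨k, hk, hkexp⟩
  -- Tietze extension of the logarithm. Replacing `ζ - z` by `exp ∘ H` off `Ω` removes its only zero
  -- and is continuous across the frontier. The resulting zero-free map on the plane has a
  -- logarithm, which is a logarithm of `ζ - z` on a circle so large that it lies in `Ω`.
  obtain ⟨H, hH⟩ := ContinuousMap.exists_restrict_eq (isClosed_frontier (s := Ω)) ⟨k, hk⟩
  have hHk : ∀ y : frontier Ω, H y = k y := fun y => DFunLike.congr_fun hH y
  set φ : ℂ → ℂ := fun ζ => if ζ ∈ Ω then ζ - z else Complex.exp (H ζ) with hφ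
  have hφc : Continuous φ := by
    refine Continuous.if (fun a ha => ?_) (by fun_prop) (by fun_prop)
    rw [hHk ⟨a, ha⟩, hkexp]
  have hφ0 : ∀ ζ, φ ζ ≠ 0 := by
    intro ζ hζ
    simp only [hφ] at hζ
    split_ifs at hζ with h
    · rw [sub_eq_zero] at hζ
      exact hz (hζ ▸ h)
    · exact Complex.exp_ne_zero _ hζ
  obtain ⟨g, ⟨-, hgexp⟩, -⟩ := Complex.isCoveringMapOn_exp.existsUnique_continuousMap_lifts
    (⟨φ, hφc⟩ : C(ℂ, ℂ)) (Complex.exp_log (hφ0 0)) hφ0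
  refine not_exists_log_on_sphere (z := z) (ρ := |R| + ‖z‖ + 1) (by positivity)
    ⟨g, g.continuous.continuousOn, fun ζ hζ => ?_⟩
  have hζΩ : ζ ∈ Ω := by
    refine hR ζ ?_
    rw [mem_sphere, dist_eq_norm] at hζ
    have := norm_sub_le ζ z
    linarith [le_abs_self R]
  have := congrFun hgexp ζ
  simp only [Function.comp, ContinuousMap.coe_mk, hφ, if_pos hζΩ] at this
  exact this

/-- If no hole disc contained `z`, each boundary component would be a point or a circle not
surrounding `z`, so it would lie in an open disc with `z` on its rim, where `y - z` has a logarithm.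
Gluing contradicts `not_exists_log_on_frontier`. -/
theorem HasCircularBoundary.exists_isHoleDisc {Ω : Set ℂ} (hb : HasCircularBoundary Ω)
    (hΩ : IsOpen Ω) (hconn : IsPreconnected Ω) {R : ℝ} (hR : ∀ z : ℂ, R ≤ ‖z‖ → z ∈ Ω) {z : ℂ}
    (hz : z ∉ closure Ω) : ∃ c r, IsHoleDisc Ω c r ∧ z ∈ ball c r := by
  by_contra! hcon
  have hcompact : IsCompact (frontier Ω) := by
    refine (isCompact_closedBall (0 : ℂ) |R|).of_isClosed_subset isClosed_frontier fun w hw => ?_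
    rw [mem_closedBall_zero_iff]
    by_contra! hlt
    rw [hΩ.frontier_eq] at hw
    exact hw.2 (hR w (by linarith [le_abs_self R]))
  have : CompactSpace (frontier Ω) := isCompact_iff_compactSpace.1 hcompact
  refine not_exists_log_on_frontier hR (fun h => hz (subset_closure h))
    (exists_continuous_log_of_components (f := fun y : frontier Ω => (y : ℂ) - z) fun x => ?_)
  have hcov : ∃ c : ℂ, c ≠ z ∧ connectedComponentIn (frontier Ω) x ⊆ ball c (dist c z) := by
    rcases hb x x.2 with ⟨c, r, hr, heq⟩ | heq
    · have hsub : sphere c r ⊆ frontier Ω := heq ▸ connectedComponentIn_subset _ _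
      have hball := hcon c r (isHoleDisc_of_sphere_subset_frontier hΩ hconn hR hr hsub)
      have hne : dist z c ≠ r := fun h =>
        hz (frontier_subset_closure (hsub (mem_sphere.2 h)))
      rw [mem_ball, not_lt] at hball
      have hlt : r < dist c z := by
        rw [dist_comm]
        exact lt_of_le_of_ne hball hne.symm
      exact ⟨c, dist_pos.1 (hr.trans hlt), heq ▸ sphere_subset_ball hlt⟩
    · have hxz : (x : ℂ) ≠ z := fun h => hz (h ▸ frontier_subset_closure x.2)
      refine ⟨x, hxz, ?_⟩
      rw [heq, singleton_subset_iff]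
      exact mem_ball_self (dist_pos.2 hxz)
  obtain ⟨c, hc, hsub⟩ := hcov
  have hz' : z ∉ ball c (dist c z) := by simp [dist_comm]
  refine ⟨(↑) ⁻¹' ball c (dist c z), isOpen_ball.preimage continuous_subtype_val, ?_,
    fun y => discLog z c y, ?_, ?_⟩
  · rw [connectedComponentIn_eq_image x.2] at hsub
    exact image_subset_iff.1 hsub
  · refine (continuousOn_discLog hc).comp continuous_subtype_val.continuousOn fun y hy => ?_
    exact ⟨ball_subset_closedBall hy, fun h => hz' (h ▸ hy)⟩
  · exact fun y hy => exp_discLog hc fun h => hz' (h ▸ hy)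

/-! ### Boundary components in the plane and on the sphere -/

section Sphere

variable {Ω : Set ℂ} {R : ℝ}

theorem coe_preimage_frontier_image_coe (Ω : Set ℂ) :
    ((↑) : ℂ → RiemannSphere) ⁻¹' frontier (((↑) : ℂ → RiemannSphere) '' Ω) = frontier Ω := by
  rw [OnePoint.isOpenMap_coe.preimage_frontier_eq_frontier_preimage OnePoint.continuous_coe,
    preimage_image_eq _ OnePoint.coe_injective]

theorem norm_le_of_mem_frontier (hΩ : IsOpen Ω) (hR : ∀ z : ℂ, R ≤ ‖z‖ → z ∈ Ω) {z : ℂ}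
    (hz : z ∈ frontier Ω) : ‖z‖ < R := by
  by_contra! h
  rw [hΩ.frontier_eq] at hz
  exact hz.2 (hR z h)

/-- The part of the spherical boundary in the plane is separated from infinity. -/
theorem exists_isOpen_separating_infty (hΩ : IsOpen Ω) (hR : ∀ z : ℂ, R ≤ ‖z‖ → z ∈ Ω) :
    ∃ u v : Set RiemannSphere, IsOpen u ∧ IsOpen v ∧ Disjoint u v ∧ OnePoint.infty ∈ v ∧
      u ⊆ range ((↑) : ℂ → RiemannSphere) ∧ ((↑) : ℂ → RiemannSphere) '' frontier Ω ⊆ u := by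
  refine ⟨((↑) : ℂ → RiemannSphere) '' ball 0 R, (((↑) : ℂ → RiemannSphere) '' closedBall 0 R)ᶜ,
    OnePoint.isOpenMap_coe _ isOpen_ball,
    OnePoint.isOpen_compl_image_coe.2 ⟨isClosed_closedBall, isCompact_closedBall _ _⟩,
    disjoint_compl_right_iff_subset.2 (image_mono ball_subset_closedBall),
    OnePoint.infty_notMem_image_coe, image_subset_range _ _, image_mono fun z hz => ?_⟩
  rw [mem_ball_zero_iff]
  exact norm_le_of_mem_frontier hΩ hR hz

theorem frontier_image_coe_subset (Ω : Set ℂ) {u v : Set RiemannSphere}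
    (hv : OnePoint.infty ∈ v) (hu : ((↑) : ℂ → RiemannSphere) '' frontier Ω ⊆ u) :
    frontier (((↑) : ℂ → RiemannSphere) '' Ω) ⊆ u ∪ v := by
  intro x hx
  induction x using OnePoint.rec with
  | infty => exact Or.inr hv
  | coe x =>
    refine Or.inl (hu ⟨x, ?_, rfl⟩)
    rwa [← coe_preimage_frontier_image_coe]

/-- On the sphere the boundary can gain only the point at infinity, which is separated from the
planar part by disjoint open sets. -/
theorem connectedComponentIn_frontier_image_coe (hΩ : IsOpen Ω)
    (hR : ∀ z : ℂ, R ≤ ‖z‖ → z ∈ Ω) {p : ℂ} (hp : p ∈ frontier Ω) :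
    connectedComponentIn (frontier (((↑) : ℂ → RiemannSphere) '' Ω)) p =
      ((↑) : ℂ → RiemannSphere) '' connectedComponentIn (frontier Ω) p := by
  have hp' : (p : RiemannSphere) ∈ frontier (((↑) : ℂ → RiemannSphere) '' Ω) := by
    rwa [← mem_preimage, coe_preimage_frontier_image_coe]
  obtain ⟨u, v, hu, hv, huv, hinf, hur, hfu⟩ := exists_isOpen_separating_infty hΩ hR
  set X := connectedComponentIn (frontier (((↑) : ℂ → RiemannSphere) '' Ω)) (p : RiemannSphere)
  have hX : X ⊆ frontier (((↑) : ℂ → RiemannSphere) '' Ω) := connectedComponentIn_subset _ _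
  have hXc : IsPreconnected X := isPreconnected_connectedComponentIn
  refine Subset.antisymm ?_ ?_
  · have hXr : X ⊆ range ((↑) : ℂ → RiemannSphere) :=
      (hXc.subset_left_of_subset_union hu hv huv
        (hX.trans (frontier_image_coe_subset Ω hinf hfu))
        ⟨p, mem_connectedComponentIn hp', hfu ⟨p, hp, rfl⟩⟩).trans hur
    rw [← image_preimage_eq_of_subset hXr]
    refine image_mono (IsPreconnected.subset_connectedComponentIn ?_ ?_ ?_)
    · exact hXc.preimage_of_isOpenMap OnePoint.coe_injective OnePoint.isOpenMap_coe hXr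
    · exact mem_connectedComponentIn hp'
    · rw [← coe_preimage_frontier_image_coe]
      exact preimage_mono hX
  · refine IsPreconnected.subset_connectedComponentIn ?_ ⟨p, mem_connectedComponentIn hp, rfl⟩ ?_
    · exact isPreconnected_connectedComponentIn.image _ OnePoint.continuous_coe.continuousOn
    · refine image_subset_iff.2 ?_
      rw [coe_preimage_frontier_image_coe]
      exact connectedComponentIn_subset _ _

theorem connectedComponentIn_frontier_image_coe_infty (hΩ : IsOpen Ω)
    (hR : ∀ z : ℂ, R ≤ ‖z‖ → z ∈ Ω)
    (hp : OnePoint.infty ∈ frontier (((↑) : ℂ → RiemannSphere) '' Ω)) :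
    connectedComponentIn (frontier (((↑) : ℂ → RiemannSphere) '' Ω)) OnePoint.infty =
      {OnePoint.infty} := by
  obtain ⟨u, v, hu, hv, huv, hinf, hur, hfu⟩ := exists_isOpen_separating_infty hΩ hR
  refine Subset.antisymm (fun x hx => ?_) (singleton_subset_iff.2 (mem_connectedComponentIn hp))
  have hxf := connectedComponentIn_subset _ _ hx
  have hxv : x ∈ v := isPreconnected_connectedComponentIn.subset_right_of_subset_union hu hv huv
    ((connectedComponentIn_subset _ _).trans (frontier_image_coe_subset Ω hinf hfu))
    ⟨_, mem_connectedComponentIn hp, hinf⟩ hx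
  induction x using OnePoint.rec with
  | infty => rfl
  | coe x =>
    refine absurd hxv (disjoint_left.1 huv (hfu ⟨x, ?_, rfl⟩))
    rwa [← coe_preimage_frontier_image_coe]

theorem IsCircleDomain.hasCircularBoundary (hΩ : IsOpen Ω) (hR : ∀ z : ℂ, R ≤ ‖z‖ → z ∈ Ω)
    (h : IsCircleDomain (((↑) : ℂ → RiemannSphere) '' Ω)) : HasCircularBoundary Ω := by
  intro p hp
  have hp' : (p : RiemannSphere) ∈ frontier (((↑) : ℂ → RiemannSphere) '' Ω) := by
    rwa [← mem_preimage, coe_preimage_frontier_image_coe]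
  have key := h.2 p hp'
  rw [connectedComponentIn_frontier_image_coe hΩ hR hp] at key
  rcases key with (⟨c, r, hr, heq⟩ | ⟨a, v, -, heq⟩) | heq
  · exact Or.inl ⟨c, r, hr, OnePoint.coe_injective.image_injective heq⟩
  · exact absurd (heq ▸ mem_insert _ _) OnePoint.infty_notMem_image_coe
  · rw [← image_singleton] at heq
    exact Or.inr (OnePoint.coe_injective.image_injective heq)

theorem HasCircularBoundary.isCircleDomain (hΩ : IsRegion Ω) (hR : ∀ z : ℂ, R ≤ ‖z‖ → z ∈ Ω)
    (h : HasCircularBoundary Ω) : IsCircleDomain (((↑) : ℂ → RiemannSphere) '' Ω) := by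
  refine ⟨⟨OnePoint.isOpenMap_coe _ hΩ.1, hΩ.2.image _ OnePoint.continuous_coe.continuousOn⟩,
    fun p hp => ?_⟩
  induction p using OnePoint.rec with
  | infty => exact Or.inr (connectedComponentIn_frontier_image_coe_infty hΩ.1 hR hp)
  | coe p =>
    have hp' : p ∈ frontier Ω := by rwa [← coe_preimage_frontier_image_coe]
    rw [connectedComponentIn_frontier_image_coe hΩ.1 hR hp']
    rcases h p hp' with ⟨c, r, hr, heq⟩ | heq
    · exact Or.inl (Or.inl ⟨c, r, hr, by rw [heq]⟩)
    · exact Or.inr (by rw [heq, image_singleton])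

end Sphere

/-! ### Rigidity and limits of hole discs -/

theorem dist_add_le_of_ball_subset_ball {z c : ℂ} {s r : ℝ} (hs : 0 < s)
    (h : ball z s ⊆ ball c r) : dist z c + s ≤ r := by
  have hcl : closedBall z s ⊆ closedBall c r := by
    rw [← closure_ball z hs.ne']
    exact closure_minimal (h.trans ball_subset_closedBall) isClosed_closedBall
  rcases eq_or_ne z c with rfl | hne
  · have hmem : z + (s : ℂ) ∈ closedBall z s := by simp [abs_of_pos hs]
    have := hcl hmem
    simp only [mem_closedBall, dist_self_add_left, Complex.norm_real, Real.norm_of_nonneg hs.le]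
      at this
    rwa [dist_self, zero_add]
  · have hd : 0 < ‖z - c‖ := norm_pos_iff.2 (sub_ne_zero.2 hne)
    -- The point of the closed disc about `z` farthest from `c`.
    have hmem : z + ((s / ‖z - c‖ : ℝ) : ℂ) * (z - c) ∈ closedBall z s := by
      rw [mem_closedBall, dist_self_add_left, norm_mul, Complex.norm_real,
        Real.norm_of_nonneg (by positivity), div_mul_cancel₀ _ hd.ne']
    have := hcl hmem
    rw [mem_closedBall, dist_eq_norm, show z + ((s / ‖z - c‖ : ℝ) : ℂ) * (z - c) - c =
      ((1 + s / ‖z - c‖ : ℝ) : ℂ) * (z - c) by push_cast; ring, norm_mul, Complex.norm_real,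
      Real.norm_of_nonneg (by positivity), add_mul, one_mul, div_mul_cancel₀ _ hd.ne'] at this
    rwa [dist_eq_norm]

theorem IsHoleDisc.disjoint_closure {Ω : Set ℂ} {c : ℂ} {r : ℝ} (h : IsHoleDisc Ω c r) :
    Disjoint (ball c r) (closure Ω) :=
  h.disjoint.closure_right isOpen_ball

/-- The bounding circle lies in `closure Ω`, so a connected set in the exterior cannot cross it. -/
theorem IsHoleDisc.subset_ball {Ω X : Set ℂ} {c : ℂ} {r : ℝ} (h : IsHoleDisc Ω c r)
    (hX : IsPreconnected X) (hdisj : Disjoint X (closure Ω)) (hne : (X ∩ ball c r).Nonempty) :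
    X ⊆ ball c r := by
  refine hX.subset_left_of_subset_union isOpen_ball
    isClosed_closedBall.isOpen_compl (disjoint_compl_right_iff_subset.2 ball_subset_closedBall)
    (fun w hw => ?_) hne
  rcases lt_trichotomy (dist w c) r with h1 | h1 | h1
  · exact Or.inl h1
  · exact absurd (h.sphere_subset (mem_sphere.2 h1)) (disjoint_left.1 hdisj hw)
  · exact Or.inr fun h2 => absurd (mem_closedBall.1 h2) (not_le.2 h1)

theorem IsHoleDisc.eq_or_disjoint {Ω : Set ℂ} {c c' : ℂ} {r r' : ℝ} (h : IsHoleDisc Ω c r)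
    (h' : IsHoleDisc Ω c' r') : (c = c' ∧ r = r') ∨ Disjoint (ball c r) (ball c' r') := by
  rw [or_iff_not_imp_right, not_disjoint_iff]
  rintro ⟨w, hw, hw'⟩
  have h1 := dist_add_le_of_ball_subset_ball h.pos
    (h'.subset_ball (convex_ball c r).isPreconnected h.disjoint_closure ⟨w, hw, hw'⟩)
  have h2 := dist_add_le_of_ball_subset_ball h'.pos
    (h.subset_ball (convex_ball c' r').isPreconnected h'.disjoint_closure ⟨w, hw', hw⟩)
  rw [dist_comm] at h2
  have := dist_nonneg (x := c) (y := c')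
  exact ⟨dist_le_zero.1 (by linarith), by linarith⟩

namespace PlanarKernelLimit

variable {Ωs : ℕ → Set ℂ} {Ω : Set ℂ} {A : ℝ}

theorem exists_isHoleDisc (hA : 1 ≤ A) (h : PlanarKernelLimit Ωs Ω)
    (hs : ∀ n, HasSteadyCurves A (Ωs n)) (hreg : ∀ n, IsRegion (Ωs n))
    (hcirc : ∀ n, HasCircularBoundary (Ωs n)) {z : ℂ} (hz : z ∉ closure Ω) :
    ∃ c r, IsHoleDisc Ω c r ∧ z ∈ ball c r := by
  have hball : ∀ {y : ℂ}, y ∉ closure Ω →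
      ∃ s > 0, ∀ᶠ n in atTop, Disjoint (ball y s) (Ωs n) := by
    intro y hy
    obtain ⟨s, hs0, hsub⟩ := Metric.isOpen_iff.1 isClosed_closure.isOpen_compl y hy
    exact ⟨s / 2, half_pos hs0, h.eventually_disjoint_ball hA hs hs0
      (disjoint_left.2 fun w hw hwΩ => hsub hw (subset_closure hwΩ))⟩
  obtain ⟨s, hs0, hdisj⟩ := hball hz
  obtain ⟨R, hR0, -, hR⟩ := h.exists_radius
  obtain ⟨u, hu⟩ := Ultrafilter.exists_le (atTop : Filter ℕ)
  -- The margin `s` keeps the limit radius positive; the bounds by `R` and `R + R` give compactness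
  -- for centres and radii.
  have hex : ∀ n, ∃ c r, (Disjoint (ball z s) (Ωs n) ∧ ∀ w : ℂ, R ≤ ‖w‖ → w ∈ Ωs n) →
      IsHoleDisc (Ωs n) c r ∧ dist z c + s ≤ r ∧ ‖c‖ ≤ R ∧ r ≤ R + R := by
    intro n
    by_cases hn : Disjoint (ball z s) (Ωs n) ∧ ∀ w : ℂ, R ≤ ‖w‖ → w ∈ Ωs n
    swap
    · exact ⟨0, 0, fun h' => absurd h' hn⟩
    have hzn : z ∉ closure (Ωs n) :=
      disjoint_left.1 (hn.1.closure_right isOpen_ball) (mem_ball_self hs0)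
    obtain ⟨c, r, hcr, hzc⟩ := (hcirc n).exists_isHoleDisc (hreg n).1
      (hreg n).2.isPreconnected hn.2 hzn
    have hsub : ball c r ⊆ ball 0 R := fun w hw => by
      rw [mem_ball_zero_iff]
      by_contra! hw'
      exact disjoint_left.1 hcr.disjoint hw (hn.2 w hw')
    have hcR := dist_add_le_of_ball_subset_ball hcr.pos hsub
    rw [dist_zero_right] at hcR
    have := norm_nonneg c
    have := hcr.pos
    exact ⟨c, r, fun _ => ⟨hcr, dist_add_le_of_ball_subset_ball hs0
      (hcr.subset_ball (convex_ball z s).isPreconnected (hn.1.closure_right isOpen_ball)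
        ⟨z, mem_ball_self hs0, hzc⟩), by linarith, by linarith⟩⟩
  choose c r hcr using hex
  have hcr' : ∀ᶠ n in u, IsHoleDisc (Ωs n) (c n) (r n) ∧ dist z (c n) + s ≤ r n ∧ ‖c n‖ ≤ R ∧
      r n ≤ R + R := ((hdisj.and hR).filter_mono hu).mono fun n hn => hcr n hn
  obtain ⟨c', -, hc⟩ := u.exists_tendsto_of_eventually_mem (f := c)
    (isCompact_closedBall (0 : ℂ) R) (hcr'.mono fun n hn => by
      rw [mem_closedBall_zero_iff]; exact hn.2.2.1)
  obtain ⟨r', -, hr⟩ := u.exists_tendsto_of_eventually_mem (f := r)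
    (isCompact_Icc (a := (0 : ℝ)) (b := R + R)) (hcr'.mono fun n hn =>
      ⟨hn.1.pos.le, hn.2.2.2⟩)
  have hzr : dist z c' + s ≤ r' := le_of_tendsto_of_tendsto
    ((tendsto_const_nhds.dist hc).add_const s) hr (hcr'.mono fun n hn => hn.2.1)
  have hr0 : 0 < r' := by linarith [dist_nonneg (x := z) (y := c')]
  refine ⟨c', r', ⟨hr0, ?_, ?_⟩, by rw [mem_ball]; linarith⟩
  · refine disjoint_left.2 fun w hw hwΩ => ?_
    rw [mem_ball] at hw
    obtain ⟨ε, hε, hev⟩ := h.eventually_ball w hwΩ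
    have hlt : ∀ᶠ n in u, dist w (c n) < r n := (tendsto_const_nhds.dist hc).eventually_lt hr hw
    obtain ⟨n, h1, h2, h3⟩ := (hlt.and ((hev.filter_mono hu).and hcr')).exists
    exact disjoint_left.1 h3.1.disjoint h1 (h2 (mem_ball_self hε))
  · intro y hy
    by_contra hyΩ
    obtain ⟨ε, hε, hev⟩ := hball hyΩ
    -- The point of the `n`-th circle in the direction of `y`. It converges to `y` and lies in the
    -- closure of the term, while a ball around `y` is eventually disjoint from the terms.
    have hlim : Tendsto (fun n => c n + ((r n / r' : ℝ) : ℂ) * (y - c')) u (𝓝 y) := by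
      have h1 : Tendsto (fun n => ((r n / r' : ℝ) : ℂ)) u (𝓝 ((r' / r' : ℝ) : ℂ)) :=
        (Complex.continuous_ofReal.tendsto _).comp (hr.div_const r')
      have h2 := hc.add (h1.mul_const (y - c'))
      rw [div_self hr0.ne'] at h2
      simpa using h2
    obtain ⟨n, h1, h2, h3⟩ := ((hlim.eventually (ball_mem_nhds y hε)).and
      ((hev.filter_mono hu).and hcr')).exists
    refine disjoint_left.1 (h2.closure_right isOpen_ball) h1 (h3.1.sphere_subset ?_)
    rw [mem_sphere, dist_self_add_left, norm_mul, Complex.norm_real,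
      Real.norm_of_nonneg (div_nonneg h3.1.pos.le hr0.le), ← dist_eq_norm, mem_sphere.1 hy,
      div_mul_cancel₀ _ hr0.ne']

end PlanarKernelLimit

/-! ### Boundary continua and branches of `log ((z - p) / (z - q))` -/

theorem tendsto_log_div_sub_cobounded (x y : ℂ) :
    Tendsto (fun z : ℂ => Complex.log ((z - x) / (z - y))) (Bornology.cobounded ℂ) (𝓝 0) := by
  have h1 : Tendsto (fun z : ℂ => 1 + (y - x) * (z - y)⁻¹) (Bornology.cobounded ℂ)
      (𝓝 (1 + (y - x) * 0)) :=
    tendsto_const_nhds.add ((tendsto_inv₀_cobounded.comp (tendsto_sub_const_cobounded y)).const_mul _)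
  rw [mul_zero, add_zero] at h1
  have h2 := h1.clog Complex.one_mem_slitPlane
  rw [Complex.log_one] at h2
  refine h2.congr' ?_
  filter_upwards [(tendsto_sub_const_cobounded y).eventually (Bornology.eventually_ne_cobounded 0)]
    with z hz
  congr 1
  field_simp
  ring

/-- Away from a connected set containing `p` and `q`, the function `(z - p) / (z - q)` has a
logarithm vanishing at infinity. -/
theorem exists_log_div_of_isPreconnected {C : Set ℂ} (hC : IsPreconnected C) {ε : ℝ} (hε : 0 < ε)
    {p q : ℂ} (hp : p ∈ C) (hq : q ∈ C) :
    ∃ g : ℂ → ℂ, ContinuousOn g {z | ∀ x ∈ C, ε ≤ dist z x} ∧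
      (∀ z, (∀ x ∈ C, ε ≤ dist z x) → Complex.exp (g z) = (z - p) / (z - q)) ∧
      Tendsto g (Bornology.cobounded ℂ) (𝓝 0) := by
  have hne : ∀ {z x : ℂ}, (∀ x ∈ C, ε ≤ dist z x) → x ∈ C → z - x ≠ 0 := by
    intro z x hz hx
    exact sub_ne_zero.2 (dist_pos.1 (hε.trans_le (hz x hx)))
  -- The property is an equivalence relation on `C` (add branches, change sign), and it holds for
  -- points closer than `ε`, where the quotient stays within distance `1` of `1` and the principal
  -- branch applies.
  refine hC.induction₂ (fun x y => ∃ g : ℂ → ℂ, ContinuousOn g {z | ∀ x ∈ C, ε ≤ dist z x} ∧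
      (∀ z, (∀ x ∈ C, ε ≤ dist z x) → Complex.exp (g z) = (z - x) / (z - y)) ∧
      Tendsto g (Bornology.cobounded ℂ) (𝓝 0)) ?_ ?_ ?_ hp hq
  · intro x hx
    filter_upwards [self_mem_nhdsWithin, mem_nhdsWithin_of_mem_nhds (ball_mem_nhds x hε)]
      with y hy hyx
    refine ⟨fun z => Complex.log ((z - x) / (z - y)), ?_, ?_, tendsto_log_div_sub_cobounded x y⟩
    · refine ContinuousOn.clog (ContinuousOn.div (by fun_prop) (by fun_prop) fun z hz =>
        hne hz hy) fun z hz => ?_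
      have hzy := hne hz hy
      have h1 : ‖(z - x) / (z - y) - 1‖ < 1 := by
        rw [show (z - x) / (z - y) - 1 = (y - x) / (z - y) by field_simp; ring, norm_div,
          div_lt_one (norm_pos_iff.2 hzy), ← dist_eq_norm, ← dist_eq_norm]
        exact (mem_ball.1 hyx).trans_le (hz y hy)
      have h2 := Complex.mem_slitPlane_of_norm_lt_one h1
      simpa using h2
    · exact fun z hz => Complex.exp_log (div_ne_zero (hne hz hx) (hne hz hy))
  · rintro x y w - hy - ⟨g, hg, hge, hg0⟩ ⟨k, hk, hke, hk0⟩
    refine ⟨fun z => g z + k z, hg.add hk, fun z hz => ?_, by simpa using hg0.add hk0⟩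
    rw [Complex.exp_add, hge z hz, hke z hz, div_mul_div_cancel₀ (hne hz hy)]
  · rintro x y - - ⟨g, hg, hge, hg0⟩
    refine ⟨fun z => -g z, hg.neg, fun z hz => ?_, by simpa using hg0.neg⟩
    rw [Complex.exp_neg, hge z hz, inv_div]

/-- A connected neighbourhood of infinity `Ω` carries a branch of `log ((z - p) / (z - q))` if `p` and `q` lie
in a connected subset of the complement. -/
theorem exists_log_div_on_domain {Ω C : Set ℂ} (hΩ : IsOpen Ω) (hconn : IsPreconnected Ω)
    {R : ℝ} (hR : ∀ z : ℂ, R ≤ ‖z‖ → z ∈ Ω) (hC : IsPreconnected C) (hCΩ : Disjoint C Ω)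
    {p q : ℂ} (hp : p ∈ C) (hq : q ∈ C) :
    ∃ g : ℂ → ℂ, ContinuousOn g Ω ∧ ∀ z ∈ Ω, Complex.exp (g z) = (z - p) / (z - q) := by
  -- The sets `W n` need not be connected, so the branches `G n` on them may disagree in places. At
  -- each point of `Ω`, however, they are eventually constant in `n`, and the eventual value is the
  -- branch sought.
  set W : ℕ → Set ℂ := fun n => {z | ∀ x ∈ C, 1 / ((n : ℝ) + 1) ≤ dist z x} with hW
  choose G hG hGe hG0 using fun n : ℕ =>
    exists_log_div_of_isPreconnected hC (ε := 1 / ((n : ℝ) + 1)) (by positivity) hp hq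
  have hloc : ∀ z ∈ Ω, ∃ ρ > 0, ball z ρ ⊆ Ω ∧ ∀ᶠ n in atTop, ball z ρ ⊆ W n := by
    intro z hz
    obtain ⟨ρ, hρ, hb⟩ := Metric.isOpen_iff.1 hΩ z hz
    refine ⟨ρ / 2, half_pos hρ, (ball_subset_ball (by linarith)).trans hb, ?_⟩
    filter_upwards [(tendsto_one_div_add_atTop_nhds_zero_nat (𝕜 := ℝ)).eventually
      (gt_mem_nhds (half_pos hρ))] with n hn w hw x hx
    have hxz : ρ ≤ dist x z := by
      by_contra! h
      exact disjoint_left.1 hCΩ hx (hb h)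
    rw [mem_ball, dist_comm] at hw
    have := dist_triangle x w z
    rw [dist_comm x w, dist_comm w z] at this
    linarith
  have hstep : ∀ {z w w' : ℂ} {ρ : ℝ}, w ∈ ball z ρ → w' ∈ ball z ρ →
      (∀ᶠ n in atTop, ball z ρ ⊆ W n) → (∃ v, ∀ᶠ n in atTop, G n w = v) →
      ∃ M, ball z ρ ⊆ W M ∧ ∀ᶠ n in atTop, EqOn (G n) (G M) (ball z ρ) := by
    rintro z w w' ρ hw hw' hev ⟨v, hv⟩
    obtain ⟨M, hM⟩ := eventually_atTop.1 (hev.and hv)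
    refine ⟨M, (hM M le_rfl).1, ?_⟩
    filter_upwards [eventually_ge_atTop M] with n hn
    refine eqOn_of_exp_eqOn (convex_ball z ρ).isPreconnected ((hG n).mono (hM n hn).1)
      ((hG M).mono (hM M le_rfl).1) (fun y hy => ?_) hw
      ((hM n hn).2.trans (hM M le_rfl).2.symm)
    rw [hGe n y ((hM n hn).1 hy), hGe M y ((hM M le_rfl).1 hy)]
  -- Along a real ray in every `W n` the difference `G n - G 0` is constant, and it tends to `0` at
  -- infinity. Connectedness of `Ω` then carries eventual constancy to every point.
  have hfar : ∃ v, ∀ᶠ n in atTop, G n ((|R| + 1 : ℝ) : ℂ) = v := by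
    have hray : ∀ x ∈ Ici (|R| + 1), ∀ n, (x : ℂ) ∈ W n := by
      intro x hx n y hy
      have h1 : ‖y‖ < R := by
        by_contra! h
        exact disjoint_left.1 hCΩ hy (hR y h)
      have h2 := norm_sub_norm_le (x : ℂ) y
      have hx' : |R| + 1 ≤ x := hx
      rw [Complex.norm_real, Real.norm_of_nonneg (by linarith [abs_nonneg R]),
        ← dist_eq_norm] at h2
      have h3 : 1 / ((n : ℝ) + 1) ≤ 1 := by
        rw [div_le_one (by positivity)]
        linarith [n.cast_nonneg (α := ℝ)]
      linarith [le_abs_self R]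
    have hof : Tendsto (fun x : ℝ => (x : ℂ)) atTop (Bornology.cobounded ℂ) := by
      rw [← tendsto_norm_atTop_iff_cobounded]
      simpa using tendsto_abs_atTop_atTop
    refine ⟨G 0 ((|R| + 1 : ℝ) : ℂ), Eventually.of_forall fun n => ?_⟩
    have hconst : ∀ x ∈ Ici (|R| + 1), G n (x : ℂ) - G 0 (x : ℂ) =
        G n ((|R| + 1 : ℝ) : ℂ) - G 0 ((|R| + 1 : ℝ) : ℂ) := by
      intro x hx
      refine sub_eqOn_const_of_exp_eqOn (f := fun x : ℝ => G n (x : ℂ))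
        (g := fun x : ℝ => G 0 (x : ℂ)) (isPreconnected_Ici (a := |R| + 1))
        ((hG n).comp Complex.continuous_ofReal.continuousOn fun y hy => hray y hy n)
        ((hG 0).comp Complex.continuous_ofReal.continuousOn fun y hy => hray y hy 0)
        (fun y hy => ?_) hx self_mem_Ici
      rw [hGe n _ (hray y hy n), hGe 0 _ (hray y hy 0)]
    have hlim := ((hG0 n).comp hof).sub ((hG0 0).comp hof)
    rw [sub_zero] at hlim
    have hlim' := tendsto_const_nhds.congr' ((eventually_ge_atTop (|R| + 1)).mono fun x hx =>
      (hconst x hx).symm)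
    exact sub_eq_zero.1 (tendsto_nhds_unique hlim' hlim)
  have hfarΩ : ((|R| + 1 : ℝ) : ℂ) ∈ Ω := hR _ (by
    rw [Complex.norm_real, Real.norm_of_nonneg (by positivity)]
    linarith [le_abs_self R])
  have hall : ∀ z ∈ Ω, ∃ v, ∀ᶠ n in atTop, G n z = v := by
    intro z hz
    refine (hconn.induction₂ (fun x y => (∃ v, ∀ᶠ n in atTop, G n x = v) ↔
      ∃ v, ∀ᶠ n in atTop, G n y = v) ?_ (fun x y z _ _ _ h h' => h.trans h')
      (fun x y _ _ h => h.symm) hfarΩ hz).1 hfar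
    intro x hx
    obtain ⟨ρ, hρ, -, hev⟩ := hloc x hx
    filter_upwards [mem_nhdsWithin_of_mem_nhds (ball_mem_nhds x hρ)] with y hy
    constructor
    · intro hv
      obtain ⟨M, -, hM⟩ := hstep (mem_ball_self hρ) hy hev hv
      exact ⟨_, hM.mono fun n hn => hn hy⟩
    · intro hv
      obtain ⟨M, -, hM⟩ := hstep hy (mem_ball_self hρ) hev hv
      exact ⟨_, hM.mono fun n hn => hn (mem_ball_self hρ)⟩
  choose! g hg using hall
  have hgG : ∀ z ∈ Ω, ∃ ρ > 0, ∃ M, ball z ρ ⊆ W M ∧ EqOn g (G M) (ball z ρ) := by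
    intro z hz
    obtain ⟨ρ, hρ, hsub, hev⟩ := hloc z hz
    obtain ⟨M, hMW, hM⟩ := hstep (mem_ball_self hρ) (mem_ball_self hρ) hev ⟨_, hg z hz⟩
    refine ⟨ρ, hρ, M, hMW, fun y hy => ?_⟩
    obtain ⟨n, h1, h2⟩ := ((hg y (hsub hy)).and hM).exists
    rw [← h1, h2 hy]
  refine ⟨g, fun z hz => ?_, fun z hz => ?_⟩
  · obtain ⟨ρ, hρ, M, hMW, hM⟩ := hgG z hz
    have h1 : ContinuousAt (G M) z := ((hG M).mono hMW).continuousAt (ball_mem_nhds z hρ)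
    exact (h1.congr (hM.symm.eventuallyEq_of_mem (ball_mem_nhds z hρ))).continuousWithinAt
  · obtain ⟨ρ, hρ, M, hMW, hM⟩ := hgG z hz
    rw [hM (mem_ball_self hρ), hGe M z (hMW (mem_ball_self hρ))]

/-- In a domain with steady curves, a branch of `log ((z - p) / (z - q))` agrees with a local branch
near each point of the closure. -/
theorem HasSteadyCurves.exists_local_branch {A : ℝ} (hA : 1 ≤ A) {Ω : Set ℂ}
    (hΩ : HasSteadyCurves A Ω) {p q : ℂ} {g : ℂ → ℂ} (hg : ContinuousOn g Ω)
    (hge : ∀ z ∈ Ω, Complex.exp (g z) = (z - p) / (z - q)) {z : ℂ} (hz : z ∈ closure Ω)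
    (hzp : z ≠ p) (hzq : z ≠ q) :
    ∃ s > 0, p ∉ ball z s ∧ q ∉ ball z s ∧ ∃ l : ℂ → ℂ, ContinuousOn l (ball z s) ∧
      (∀ ζ ∈ ball z s, Complex.exp (l ζ) = (ζ - p) / (ζ - q)) ∧ EqOn g l (Ω ∩ ball z s) := by
  set ρ := min (dist z p) (dist z q) with hρ
  have hρ0 : 0 < ρ := lt_min (dist_pos.2 hzp) (dist_pos.2 hzq)
  have hρp : p ∉ ball z ρ := fun h => by
    rw [mem_ball, dist_comm] at h
    exact absurd h (not_lt.2 (min_le_left _ _))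
  have hρq : q ∉ ball z ρ := fun h => by
    rw [mem_ball, dist_comm] at h
    exact absurd h (not_lt.2 (min_le_right _ _))
  set L : ℂ → ℂ := fun ζ => discLog p z ζ - discLog q z ζ with hL
  have hLc : ContinuousOn L (ball z ρ) := by
    refine ((continuousOn_discLog hzp).mono fun ζ hζ => ⟨?_, fun h => hρp (h ▸ hζ)⟩).sub
      ((continuousOn_discLog hzq).mono fun ζ hζ => ⟨?_, fun h => hρq (h ▸ hζ)⟩)
    · exact (mem_ball.1 hζ).le.trans (min_le_left _ _)
    · exact (mem_ball.1 hζ).le.trans (min_le_right _ _)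
  have hLe : ∀ ζ ∈ ball z ρ, Complex.exp (L ζ) = (ζ - p) / (ζ - q) := fun ζ hζ => by
    rw [hL, Complex.exp_sub, exp_discLog hzp fun h => hρp (h ▸ hζ),
      exp_discLog hzq fun h => hρq (h ▸ hζ)]
  -- Points `a`, `b` in `ball z s` are joined by a curve of length at most `2 * A * s`, which stays
  -- within `(2 * A + 1) * s = ρ` of `z`. Along it `g` and `L` differ by a constant.
  set s := ρ / (2 * A + 1) with hs
  have hs0 : 0 < s := by positivity
  have hsρ : s * (2 * A + 1) = ρ := by rw [hs]; field_simp
  have hsub : ball z s ⊆ ball z ρ := ball_subset_ball (by nlinarith)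
  obtain ⟨a, haz, haΩ⟩ := mem_closure_iff.1 hz (ball z s) isOpen_ball (mem_ball_self hs0)
  have hconst : ∀ b ∈ Ω ∩ ball z s, g b - L b = g a - L a := by
    rintro b ⟨hbΩ, hbz⟩
    obtain ⟨r, β, hβ⟩ := hΩ a haΩ b hbΩ
    have hmem := hβ.mem hA haΩ hbΩ
    have hβball : ∀ t ∈ Icc (0 : ℝ) 1, β t ∈ ball z ρ := by
      intro t ht
      have h1 := hβ.dist_le t ht 0 (by simp)
      rw [hβ.zero, sub_zero, abs_of_nonneg ht.1] at h1
      have h2 := mul_le_of_le_one_right hβ.length_nonneg ht.2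
      have h3 := hβ.length_le
      have h4 := dist_triangle (β t) a z
      have h5 := dist_triangle_right a b z
      rw [mem_ball] at haz hbz ⊢
      have h6 : A * dist a b ≤ A * (2 * s) := by gcongr; linarith
      linarith
    have hβc := hβ.lipschitzOnWith.continuousOn
    have := sub_eqOn_const_of_exp_eqOn (f := fun t => g (β t)) (g := fun t => L (β t))
      (isPreconnected_Icc (a := (0 : ℝ)) (b := 1)) (hg.comp hβc hmem) (hLc.comp hβc hβball)
      (fun t ht => by rw [hge _ (hmem t ht), hLe _ (hβball t ht)])
      (right_mem_Icc.2 zero_le_one) (left_mem_Icc.2 zero_le_one)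
    simpa only [hβ.zero, hβ.one] using this
  refine ⟨s, hs0, fun h => hρp (hsub h), fun h => hρq (hsub h), fun ζ => L ζ + (g a - L a),
    (hLc.mono hsub).add continuousOn_const, fun ζ hζ => ?_, fun b hb => ?_⟩
  · rw [Complex.exp_add, Complex.exp_sub (g a), hge a haΩ, hLe a (hsub haz),
      div_self, mul_one, hLe ζ (hsub hζ)]
    rw [← hge a haΩ]
    exact Complex.exp_ne_zero _
  · simp only
    rw [← hconst b hb]
    ring

/-- On a small circle around `p`, adding a branch of `log (ζ - q)` would give a logarithm of `ζ -
p`. -/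
theorem not_exists_log_div {p q : ℂ} (hpq : p ≠ q) :
    ¬ ∃ g : ℂ → ℂ, ContinuousOn g {p, q}ᶜ ∧
      ∀ z ∈ ({p, q}ᶜ : Set ℂ), Complex.exp (g z) = (z - p) / (z - q) := by
  rintro ⟨g, hg, hge⟩
  have hd : 0 < dist p q := dist_pos.2 hpq
  have hs : ∀ ζ ∈ sphere p (dist p q / 2), ζ ≠ p ∧ ζ ≠ q := by
    intro ζ hζ
    rw [mem_sphere] at hζ
    constructor
    · rintro rfl
      rw [dist_self] at hζ
      linarith
    · rintro rfl
      rw [dist_comm] at hζ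
      linarith
  refine not_exists_log_on_sphere (z := p) (half_pos hd)
    ⟨fun ζ => g ζ + discLog q p ζ, (hg.mono fun ζ hζ => ?_).add
      ((continuousOn_discLog hpq).mono fun ζ hζ => ⟨?_, (hs ζ hζ).2⟩), fun ζ hζ => ?_⟩
  · simpa using hs ζ hζ
  · rw [mem_closedBall, mem_sphere.1 hζ]
    linarith
  · rw [Complex.exp_add, hge ζ (by simpa using hs ζ hζ), exp_discLog hpq (hs ζ hζ).2,
      div_mul_cancel₀ _ (sub_ne_zero.2 (hs ζ hζ).2)]

theorem isPreconnected_sphere_diff_singleton (c p : ℂ) (r : ℝ) :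
    IsPreconnected (sphere c r \ {p}) := by
  by_cases hp : p ∈ sphere c r
  swap
  · rw [sdiff_singleton_eq_self hp]
    exact isPreconnected_sphere (by rw [Complex.rank_real_complex]; norm_num) c r
  rcases eq_or_ne p c with rfl | hpc
  · rw [mem_sphere, dist_self] at hp
    rw [← hp, sphere_zero, Set.sdiff_self]
    exact isPreconnected_empty
  have hpc' : p - c ≠ 0 := sub_ne_zero.2 hpc
  have himage : sphere c r \ {p} =
      (fun θ : ℝ => c - (p - c) * Complex.exp (θ * Complex.I)) '' Ioo (-Real.pi) Real.pi := by
    ext z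
    constructor
    · rintro ⟨hz, hzp⟩
      set w := -((z - c) / (p - c)) with hw
      have hnorm : ‖w‖ = 1 := by
        rw [hw, norm_neg, norm_div, ← dist_eq_norm, ← dist_eq_norm, mem_sphere.1 hz,
          mem_sphere.1 hp, div_self]
        rw [← mem_sphere.1 hp]
        exact dist_ne_zero.2 hpc
      have hexp : Complex.exp (w.arg * Complex.I) = w := by
        have := Complex.norm_mul_exp_arg_mul_I w
        rwa [hnorm, Complex.ofReal_one, one_mul] at this
      refine ⟨w.arg, ⟨Complex.neg_pi_lt_arg w, lt_of_le_of_ne (Complex.arg_le_pi w) ?_⟩, ?_⟩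
      · intro h
        rw [h, Complex.exp_pi_mul_I, hw, neg_inj, eq_comm, div_eq_one_iff_eq hpc'] at hexp
        exact hzp (sub_left_injective hexp)
      · simp only
        rw [hexp, hw]
        field_simp
        ring
    · rintro ⟨θ, hθ, rfl⟩
      refine ⟨?_, fun h => ?_⟩
      · rw [mem_sphere, dist_eq_norm, sub_sub_cancel_left, norm_neg, norm_mul,
          Complex.norm_exp_ofReal_mul_I, mul_one, ← dist_eq_norm]
        exact hp
      · have h1 : Complex.exp (θ * Complex.I) = -1 := by
          have h2 : (p - c) * Complex.exp (θ * Complex.I) = (p - c) * (-1) := by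
            have h3 : c - (p - c) * Complex.exp (θ * Complex.I) = p := h
            linear_combination -h3
          exact mul_left_cancel₀ hpc' h2
        have h4 := Complex.arg_exp_mul_I θ
        rw [h1, Complex.arg_neg_one, (toIocMod_eq_self Real.two_pi_pos).2
          ⟨hθ.1, by linarith [hθ.2]⟩] at h4
        exact hθ.2.ne' h4
  rw [himage]
  exact isPreconnected_Ioo.image _ (by fun_prop)

/-- If the exterior of a uniform domain is a union of hole discs, then two distinct points of a
connected subset of the boundary lie on the boundary circle of the same hole disc. -/
theorem HasSteadyCurves.exists_isHoleDisc_of_isPreconnected {A : ℝ} (hA : 1 ≤ A) {Ω C : Set ℂ}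
    (hs : HasSteadyCurves A Ω) (hΩ : IsRegion Ω) {R : ℝ} (hR : ∀ z : ℂ, R ≤ ‖z‖ → z ∈ Ω)
    (hdisc : ∀ z, z ∉ closure Ω → ∃ c r, IsHoleDisc Ω c r ∧ z ∈ ball c r)
    (hC : IsPreconnected C) (hCΩ : C ⊆ frontier Ω) {p q : ℂ} (hp : p ∈ C) (hq : q ∈ C)
    (hpq : p ≠ q) : ∃ c r, IsHoleDisc Ω c r ∧ p ∈ sphere c r ∧ q ∈ sphere c r := by
  classical
  by_contra! hcon
  have hpcl : p ∈ closure Ω := frontier_subset_closure (hCΩ hp)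
  have hqcl : q ∈ closure Ω := frontier_subset_closure (hCΩ hq)
  have hCdisj : Disjoint C Ω := disjoint_left.2 fun x hx hxΩ => by
    have := hCΩ hx
    rw [hΩ.1.frontier_eq] at this
    exact this.2 hxΩ
  obtain ⟨g, hg, hge⟩ := exists_log_div_on_domain hΩ.1 hΩ.2.isPreconnected hR hC hCdisj hp hq
  have hlocal : ∀ z, ∃ s, ∃ l : ℂ → ℂ, z ∈ closure Ω → z ≠ p → z ≠ q →
      0 < s ∧ p ∉ ball z s ∧ q ∉ ball z s ∧ ContinuousOn l (ball z s) ∧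
      (∀ ζ ∈ ball z s, Complex.exp (l ζ) = (ζ - p) / (ζ - q)) ∧ EqOn g l (Ω ∩ ball z s) := by
    intro z
    by_cases hz : z ∈ closure Ω ∧ z ≠ p ∧ z ≠ q
    · obtain ⟨s, h1, h2, h3, l, h4⟩ :=
        hs.exists_local_branch hA hg hge hz.1 hz.2.1 hz.2.2
      exact ⟨s, l, fun _ _ _ => ⟨h1, h2, h3, h4⟩⟩
    · exact ⟨0, 0, fun h1 h2 h3 => absurd ⟨h1, h2, h3⟩ hz⟩
  choose s l hl using hlocal
  -- Both sides are limits of `g` at `y` from within `Ω`. So `y ↦ l y y` is the continuous extension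
  -- of `g` to the closure away from `p` and `q`.
  have hagree : ∀ z ∈ closure Ω, z ≠ p → z ≠ q → ∀ y ∈ closure Ω, y ∈ ball z (s z) →
      l y y = l z y := by
    intro z hz hzp hzq y hy hyz
    obtain ⟨-, hpz, hqz, hlz, -, hgz⟩ := hl z hz hzp hzq
    obtain ⟨hsy, -, -, hly, -, hgy⟩ := hl y hy (fun h => hpz (h ▸ hyz)) (fun h => hqz (h ▸ hyz))
    have : (𝓝[Ω] y).NeBot := mem_closure_iff_nhdsWithin_neBot.1 hy
    have h1 : Tendsto (l y) (𝓝[Ω] y) (𝓝 (l y y)) :=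
      (hly.continuousAt (ball_mem_nhds y hsy)).tendsto.mono_left nhdsWithin_le_nhds
    have h2 : Tendsto (l z) (𝓝[Ω] y) (𝓝 (l z y)) :=
      (hlz.continuousAt (isOpen_ball.mem_nhds hyz)).tendsto.mono_left nhdsWithin_le_nhds
    refine tendsto_nhds_unique h1 (h2.congr' ?_)
    filter_upwards [self_mem_nhdsWithin, mem_nhdsWithin_of_mem_nhds (ball_mem_nhds y hsy),
      mem_nhdsWithin_of_mem_nhds (isOpen_ball.mem_nhds hyz)] with w hwΩ hwy hwz
    rw [← hgz ⟨hwΩ, hwz⟩, ← hgy ⟨hwΩ, hwy⟩]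
  have hboundary : ContinuousOn (fun y => l y y) (closure Ω \ {p, q}) := by
    rintro z ⟨hz, hzpq⟩
    simp only [mem_insert_iff, mem_singleton_iff, not_or] at hzpq
    obtain ⟨hsz, hpz, hqz, hlz, -, -⟩ := hl z hz hzpq.1 hzpq.2
    refine ((hlz.continuousAt (ball_mem_nhds z hsz)).continuousWithinAt (s := closure Ω \ {p, q})
      ).congr_of_eventuallyEq ?_ rfl
    filter_upwards [self_mem_nhdsWithin, mem_nhdsWithin_of_mem_nhds (ball_mem_nhds z hsz)]
      with y hy hyz using hagree z hz hzpq.1 hzpq.2 y hy.1 hyz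
  have hfill : ∀ c r, ∃ k : ℂ → ℂ, IsHoleDisc Ω c r →
      ContinuousOn k (closedBall c r \ {p, q}) ∧
      (∀ ζ ∈ closedBall c r \ {p, q}, Complex.exp (k ζ) = (ζ - p) / (ζ - q)) ∧
      EqOn k (fun y => l y y) (sphere c r \ {p, q}) := by
    intro c r
    by_cases hcr : IsHoleDisc Ω c r
    swap
    · exact ⟨0, fun h => absurd h hcr⟩
    have hout : ∀ {x : ℂ}, x ∈ closure Ω → r ≤ dist c x := by
      intro x hx
      by_contra! h
      rw [dist_comm] at h
      exact disjoint_left.1 hcr.disjoint_closure h hx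
    have hcp : c ≠ p := dist_pos.1 (hcr.pos.trans_le (hout hpcl))
    have hcq : c ≠ q := dist_pos.1 (hcr.pos.trans_le (hout hqcl))
    set L : ℂ → ℂ := fun ζ => discLog p c ζ - discLog q c ζ with hL
    have hLc : ContinuousOn L (closedBall c r \ {p, q}) := by
      refine ((continuousOn_discLog hcp).mono ?_).sub ((continuousOn_discLog hcq).mono ?_)
      · exact fun ζ hζ => ⟨closedBall_subset_closedBall (hout hpcl) hζ.1, fun h => hζ.2 (Or.inl h)⟩
      · exact fun ζ hζ => ⟨closedBall_subset_closedBall (hout hqcl) hζ.1, fun h => hζ.2 (Or.inr h)⟩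
    have hLe : ∀ ζ ∈ closedBall c r \ {p, q}, Complex.exp (L ζ) = (ζ - p) / (ζ - q) := by
      intro ζ hζ
      rw [hL, Complex.exp_sub, exp_discLog hcp fun h => hζ.2 (Or.inl h),
        exp_discLog hcq fun h => hζ.2 (Or.inr h)]
    have hdiff : sphere c r \ {p, q} = (sphere c r \ {p}) \ {q} := by
      ext x
      simp [and_assoc]
    -- Here the assumed failure enters: at most one of `p`, `q` is on the circle, so what remains is
    -- connected and one additive constant matches the disc branch to the boundary values.
    have hpre : IsPreconnected (sphere c r \ {p, q}) := by
      by_cases hps : p ∈ sphere c r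
      · have hqs := hcon c r hcr hps
        rw [hdiff, sdiff_singleton_eq_self (a := q) fun h => hqs h.1]
        exact isPreconnected_sphere_diff_singleton c p r
      · rw [hdiff, sdiff_singleton_eq_self hps]
        exact isPreconnected_sphere_diff_singleton c q r
    have hsub : sphere c r \ {p, q} ⊆ closedBall c r \ {p, q} :=
      sdiff_subset_sdiff_left sphere_subset_closedBall
    have hsub' : sphere c r \ {p, q} ⊆ closure Ω \ {p, q} :=
      sdiff_subset_sdiff_left hcr.sphere_subset
    have hbe : ∀ ζ ∈ closure Ω \ {p, q}, Complex.exp (l ζ ζ) = (ζ - p) / (ζ - q) := by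
      rintro ζ ⟨hζ, hζpq⟩
      simp only [mem_insert_iff, mem_singleton_iff, not_or] at hζpq
      obtain ⟨hsζ, -, -, -, hle, -⟩ := hl ζ hζ hζpq.1 hζpq.2
      exact hle ζ (mem_ball_self hsζ)
    rcases (sphere c r \ {p, q}).eq_empty_or_nonempty with hemp | ⟨y, hy⟩
    · exact ⟨L, fun _ => ⟨hLc, hLe, by rw [hemp]; exact eqOn_empty _ _⟩⟩
    refine ⟨fun ζ => L ζ + (l y y - L y), fun _ => ⟨hLc.add continuousOn_const, fun ζ hζ => ?_,
      fun ζ hζ => ?_⟩⟩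
    · have h0 := Complex.exp_ne_zero (L y)
      rw [Complex.exp_add, Complex.exp_sub (l y y), hLe ζ hζ, hbe y (hsub' hy), ← hLe y (hsub hy),
        div_self h0, mul_one]
    · have := sub_eqOn_const_of_exp_eqOn hpre (hboundary.mono hsub') (hLc.mono hsub)
        (fun ζ hζ => by rw [hbe ζ (hsub' hζ), hLe ζ (hsub hζ)]) hy hζ
      simp only
      rw [this]
      ring
  choose k hk using hfill
  choose! c r hcr hmem using hdisc
  set G : ℂ → ℂ := fun z => if z ∈ closure Ω then l z z else k (c z) (r z) z with hG
  have hpqball : ∀ z, z ∉ closure Ω → ∀ ζ ∈ ball (c z) (r z), ζ ∉ ({p, q} : Set ℂ) := by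
    rintro z hz ζ hζ (rfl | rfl)
    · exact disjoint_left.1 (hcr z hz).disjoint_closure hζ hpcl
    · exact disjoint_left.1 (hcr z hz).disjoint_closure hζ hqcl
  have hGout : ∀ z, z ∉ closure Ω → EqOn G (k (c z) (r z)) (ball (c z) (r z)) := by
    intro z hz y hy
    have hyΩ : y ∉ closure Ω := disjoint_left.1 (hcr z hz).disjoint_closure hy
    have heq : c z = c y ∧ r z = r y := ((hcr z hz).eq_or_disjoint (hcr y hyΩ)).resolve_right
      (not_disjoint_iff.2 ⟨y, hy, hmem y hyΩ⟩)
    simp only [hG, if_neg hyΩ, heq.1, heq.2]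
  -- Continuity of `G` at `z` is not automatic, as infinitely many hole discs may accumulate there.
  -- A closed hole disc meets `ball z (s z)` in a convex set; if the open disc does too, that set
  -- contains a point of the circle, where the branches agree.
  have hGin : ∀ z ∈ closure Ω, z ≠ p → z ≠ q → EqOn G (l z) (ball z (s z)) := by
    intro z hz hzp hzq y hy
    by_cases hyΩ : y ∈ closure Ω
    · simp only [hG, if_pos hyΩ]
      exact hagree z hz hzp hzq y hyΩ hy
    simp only [hG, if_neg hyΩ]
    obtain ⟨hsz, hpz, hqz, hlz, hle, -⟩ := hl z hz hzp hzq
    obtain ⟨hkc, hke, hkb⟩ := hk _ _ (hcr y hyΩ)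
    have hzball : z ∉ ball (c y) (r y) := fun h =>
      disjoint_left.1 (hcr y hyΩ).disjoint_closure h hz
    have hpqz : ∀ ζ ∈ ball z (s z), ζ ∉ ({p, q} : Set ℂ) := by
      rintro ζ hζ (rfl | rfl)
      · exact hpz hζ
      · exact hqz hζ
    obtain ⟨w, hws, hwb⟩ : ∃ w ∈ sphere (c y) (r y), w ∈ ball z (s z) := by
      have hseg : IsPreconnected (segment ℝ y z) := (convex_segment y z).isPreconnected
      have hcont : ContinuousOn (fun w => dist w (c y)) (segment ℝ y z) := by fun_prop
      obtain ⟨w, hw, hwr⟩ := hseg.intermediate_value (left_mem_segment ℝ y z)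
        (right_mem_segment ℝ y z) hcont
        ⟨(mem_ball.1 (hmem y hyΩ)).le, not_lt.1 fun h => hzball (mem_ball.2 h)⟩
      exact ⟨w, hwr, (convex_ball z (s z)).segment_subset hy (mem_ball_self hsz) hw⟩
    have hconv : IsPreconnected (closedBall (c y) (r y) ∩ ball z (s z)) :=
      ((convex_closedBall _ _).inter (convex_ball _ _)).isPreconnected
    have hsub : closedBall (c y) (r y) ∩ ball z (s z) ⊆ closedBall (c y) (r y) \ {p, q} :=
      fun ζ hζ => ⟨hζ.1, hpqz ζ hζ.2⟩
    refine eqOn_of_exp_eqOn hconv (hkc.mono hsub) (hlz.mono inter_subset_right)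
      (fun ζ hζ => by rw [hke ζ (hsub hζ), hle ζ hζ.2]) ⟨sphere_subset_closedBall hws, hwb⟩ ?_
      ⟨ball_subset_closedBall (hmem y hyΩ), hy⟩
    rw [hkb ⟨hws, hpqz w hwb⟩]
    exact hagree z hz hzp hzq w ((hcr y hyΩ).sphere_subset hws) hwb
  refine not_exists_log_div hpq ⟨G, fun z hz => ?_, fun z hz => ?_⟩
  all_goals
    simp only [mem_compl_iff, mem_insert_iff, mem_singleton_iff, not_or] at hz
    by_cases hzΩ : z ∈ closure Ω
  · obtain ⟨hsz, -, -, hlz, -, -⟩ := hl z hzΩ hz.1 hz.2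
    exact ((hlz.continuousAt (ball_mem_nhds z hsz)).congr ((hGin z hzΩ hz.1 hz.2).symm
      |>.eventuallyEq_of_mem (ball_mem_nhds z hsz))).continuousWithinAt
  · have hnhds := isOpen_ball.mem_nhds (hmem z hzΩ)
    obtain ⟨hkc, -, -⟩ := hk _ _ (hcr z hzΩ)
    have hkc' : ContinuousAt (k (c z) (r z)) z := (hkc.mono fun ζ hζ =>
      ⟨ball_subset_closedBall hζ, hpqball z hzΩ ζ hζ⟩).continuousAt hnhds
    exact (hkc'.congr ((hGout z hzΩ).symm.eventuallyEq_of_mem hnhds)).continuousWithinAt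
  · obtain ⟨hsz, -, -, -, hle, -⟩ := hl z hzΩ hz.1 hz.2
    rw [hGin z hzΩ hz.1 hz.2 (mem_ball_self hsz), hle z (mem_ball_self hsz)]
  · obtain ⟨-, hke, -⟩ := hk _ _ (hcr z hzΩ)
    rw [hGout z hzΩ (hmem z hzΩ),
      hke z ⟨ball_subset_closedBall (hmem z hzΩ), hpqball z hzΩ z (hmem z hzΩ)⟩]

/-! ### Tangent discs and the shape of boundary components -/

theorem tangent_of_disjoint_ball {c c' s : ℂ} {r r' : ℝ} (hr : 0 < r) (hr' : 0 < r')
    (h : Disjoint (ball c r) (ball c' r')) (hs : s ∈ sphere c r) (hs' : s ∈ sphere c' r') :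
    (r : ℂ) * (c' - s) + r' * (c - s) = 0 := by
  rw [disjoint_ball_ball_iff hr hr'] at h
  have h1 : ‖c - s‖ ^ 2 = r ^ 2 := by rw [← dist_eq_norm, dist_comm, mem_sphere.1 hs]
  have h2 : ‖c' - s‖ ^ 2 = r' ^ 2 := by rw [← dist_eq_norm, dist_comm, mem_sphere.1 hs']
  have h3 : (r + r') ^ 2 ≤ ‖(c - s) - (c' - s)‖ ^ 2 := by
    rw [sub_sub_sub_cancel_right, ← dist_eq_norm]
    gcongr
  generalize c - s = u at h1 h3 ⊢
  generalize c' - s = v at h2 h3 ⊢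
  rw [← Complex.normSq_eq_norm_sq, Complex.normSq_apply] at h1 h2 h3
  simp only [Complex.sub_re, Complex.sub_im] at h3
  have h4 : u.re * v.re + u.im * v.im ≤ -(r * r') := by linarith
  -- The left side is `2 * r * r'` times `r * r'` plus the inner product of `u` and `v`: equality in
  -- the triangle inequality makes the radii opposite.
  have h5 : (r * v.re + r' * u.re) ^ 2 + (r * v.im + r' * u.im) ^ 2 ≤ 0 := by
    have h6 : (r * v.re + r' * u.re) ^ 2 + (r * v.im + r' * u.im) ^ 2 =
        r ^ 2 * (v.re * v.re + v.im * v.im) + r' ^ 2 * (u.re * u.re + u.im * u.im) +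
        2 * (r * r') * (u.re * v.re + u.im * v.im) := by ring
    have h7 : 2 * (r * r') * (u.re * v.re + u.im * v.im) ≤ 2 * (r * r') * -(r * r') := by gcongr
    rw [h6, h1, h2]
    linarith
  have h8 := sq_nonneg (r * v.re + r' * u.re)
  have h9 := sq_nonneg (r * v.im + r' * u.im)
  have h10 : r * v.re + r' * u.re = 0 := pow_eq_zero_iff two_ne_zero |>.1 (by linarith)
  have h11 : r * v.im + r' * u.im = 0 := pow_eq_zero_iff two_ne_zero |>.1 (by linarith)
  apply Complex.ext
  · simpa using h10
  · simpa using h11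

/-- Tangency makes the common point the average of the centres with weights `r'` and `r`. -/
theorem eq_of_mem_sphere_of_disjoint_ball {c c' s t : ℂ} {r r' : ℝ} (hr : 0 < r) (hr' : 0 < r')
    (h : Disjoint (ball c r) (ball c' r')) (hs : s ∈ sphere c r) (hs' : s ∈ sphere c' r')
    (ht : t ∈ sphere c r) (ht' : t ∈ sphere c' r') : s = t := by
  have h1 := tangent_of_disjoint_ball hr hr' h hs hs'
  have h2 := tangent_of_disjoint_ball hr hr' h ht ht'
  have h3 : ((r + r' : ℝ) : ℂ) ≠ 0 := Complex.ofReal_ne_zero.2 (by positivity)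
  refine mul_left_cancel₀ h3 ?_
  push_cast
  linear_combination h2 - h1

/-- The directions from `s` to the centres would be pairwise opposite, which three directions cannot
be. -/
theorem not_pairwise_disjoint_ball {s c₁ c₂ c₃ : ℂ} {r₁ r₂ r₃ : ℝ} (hr₁ : 0 < r₁) (hr₂ : 0 < r₂)
    (hr₃ : 0 < r₃) (hs₁ : s ∈ sphere c₁ r₁) (hs₂ : s ∈ sphere c₂ r₂) (hs₃ : s ∈ sphere c₃ r₃)
    (h₁₂ : Disjoint (ball c₁ r₁) (ball c₂ r₂)) (h₁₃ : Disjoint (ball c₁ r₁) (ball c₃ r₃))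
    (h₂₃ : Disjoint (ball c₂ r₂) (ball c₃ r₃)) : False := by
  have e₁ := tangent_of_disjoint_ball hr₁ hr₂ h₁₂ hs₁ hs₂
  have e₂ := tangent_of_disjoint_ball hr₁ hr₃ h₁₃ hs₁ hs₃
  have e₃ := tangent_of_disjoint_ball hr₂ hr₃ h₂₃ hs₂ hs₃
  have h : ((2 * r₂ * r₃ : ℝ) : ℂ) * (c₁ - s) = 0 := by
    push_cast
    linear_combination (r₃ : ℂ) * e₁ + (r₂ : ℂ) * e₂ - (r₁ : ℂ) * e₃
  have h' : c₁ - s = 0 := (mul_eq_zero.1 h).resolve_left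
    (Complex.ofReal_ne_zero.2 (by positivity))
  rw [mem_sphere, sub_eq_zero.1 h', dist_self] at hs₁
  exact hr₁.ne hs₁

/-- A nondegenerate component contains a whole hole circle. A further point `s` would share a hole
circle with each point `t` of it. These discs touch the first one only at `t`, so distinct `t` give
disjoint discs, and three of them would meet at `s`. -/
theorem HasSteadyCurves.hasCircularBoundary {A : ℝ} (hA : 1 ≤ A) {Ω : Set ℂ}
    (hs : HasSteadyCurves A Ω) (hΩ : IsRegion Ω) {R : ℝ} (hR : ∀ z : ℂ, R ≤ ‖z‖ → z ∈ Ω)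
    (hdisc : ∀ z, z ∉ closure Ω → ∃ c r, IsHoleDisc Ω c r ∧ z ∈ ball c r) :
    HasCircularBoundary Ω := by
  intro p hp
  set X := connectedComponentIn (frontier Ω) p with hX
  have hpX : p ∈ X := mem_connectedComponentIn hp
  have hXc : IsPreconnected X := isPreconnected_connectedComponentIn
  have hXf : X ⊆ frontier Ω := connectedComponentIn_subset _ _
  have hcommon : ∀ {a b : ℂ}, a ∈ X → b ∈ X → a ≠ b →
      ∃ c r, IsHoleDisc Ω c r ∧ a ∈ sphere c r ∧ b ∈ sphere c r := fun ha hb hab =>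
    hs.exists_isHoleDisc_of_isPreconnected hA hΩ hR hdisc hXc hXf ha hb hab
  by_cases hsingle : X = {p}
  · exact Or.inr hsingle
  obtain ⟨q, hq, hqp⟩ : ∃ q ∈ X, q ≠ p := by
    by_contra! h
    exact hsingle (Subset.antisymm (fun x hx => h x hx) (singleton_subset_iff.2 hpX))
  obtain ⟨c, r, hcr, hpc, -⟩ := hcommon hpX hq hqp.symm
  have hsphere : sphere c r ⊆ X := by
    refine IsPreconnected.subset_connectedComponentIn
      (isPreconnected_sphere (by rw [Complex.rank_real_complex]; norm_num) c r) hpc fun x hx => ?_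
    rw [hΩ.1.frontier_eq]
    refine ⟨hcr.sphere_subset hx, fun hxΩ => ?_⟩
    refine disjoint_left.1 (hcr.disjoint.closure_left hΩ.1) ?_ hxΩ
    rw [closure_ball c hcr.pos.ne']
    exact sphere_subset_closedBall hx
  refine Or.inl ⟨c, r, hcr.pos, Subset.antisymm (fun s hsX => ?_) hsphere⟩
  by_contra hsc
  have htangent : ∀ t ∈ sphere c r, ∃ c' r', IsHoleDisc Ω c' r' ∧ t ∈ sphere c' r' ∧
      s ∈ sphere c' r' ∧ Disjoint (ball c r) (ball c' r') := by
    intro t ht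
    obtain ⟨c', r', hcr', ht', hs'⟩ := hcommon (hsphere ht) hsX fun h => hsc (h ▸ ht)
    refine ⟨c', r', hcr', ht', hs', (hcr.eq_or_disjoint hcr').resolve_left ?_⟩
    rintro ⟨rfl, rfl⟩
    exact hsc hs'
  have hdisjoint : ∀ {t t' c₁ c₂ : ℂ} {r₁ r₂ : ℝ}, t ∈ sphere c r → t' ∈ sphere c r → t ≠ t' →
      IsHoleDisc Ω c₁ r₁ → IsHoleDisc Ω c₂ r₂ → t ∈ sphere c₁ r₁ → t' ∈ sphere c₂ r₂ →
      Disjoint (ball c r) (ball c₁ r₁) → Disjoint (ball c₁ r₁) (ball c₂ r₂) := by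
    intro t t' c₁ c₂ r₁ r₂ ht ht' hne h₁ h₂ ht₁ ht₂ hd
    refine (h₁.eq_or_disjoint h₂).resolve_left ?_
    rintro ⟨rfl, rfl⟩
    exact hne (eq_of_mem_sphere_of_disjoint_ball hcr.pos h₁.pos hd ht ht₁ ht' ht₂)
  have hr0 : (r : ℂ) ≠ 0 := Complex.ofReal_ne_zero.2 hcr.pos.ne'
  have hmem : ∀ {u : ℂ}, ‖u‖ = 1 → c + r * u ∈ sphere c r := by
    intro u hu
    rw [mem_sphere, dist_self_add_left, norm_mul, hu, mul_one, Complex.norm_real,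
      Real.norm_of_nonneg hcr.pos.le]
  have hne : ∀ {u v : ℂ}, u ≠ v → c + r * u ≠ c + r * v := fun huv h =>
    huv (mul_left_cancel₀ hr0 (add_left_cancel h))
  have m₁ : c + r * (1 : ℂ) ∈ sphere c r := hmem (by simp)
  have m₂ : c + r * (-1 : ℂ) ∈ sphere c r := hmem (by simp)
  have m₃ : c + r * Complex.I ∈ sphere c r := hmem (by simp)
  obtain ⟨c₁, r₁, h₁, t₁, s₁, d₁⟩ := htangent _ m₁
  obtain ⟨c₂, r₂, h₂, t₂, s₂, d₂⟩ := htangent _ m₂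
  obtain ⟨c₃, r₃, h₃, t₃, s₃, d₃⟩ := htangent _ m₃
  exact not_pairwise_disjoint_ball h₁.pos h₂.pos h₃.pos s₁ s₂ s₃
    (hdisjoint m₁ m₂ (hne (by norm_num)) h₁ h₂ t₁ t₂ d₁)
    (hdisjoint m₁ m₃ (hne (by simp [Complex.ext_iff])) h₁ h₃ t₁ t₃ d₁)
    (hdisjoint m₂ m₃ (hne (by simp [Complex.ext_iff])) h₂ h₃ t₂ t₃ d₂)

/-! ### Conclusion -/

theorem exists_radius_finitePart {D : Set RiemannSphere} (hD : IsOpen D)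
    (hinf : OnePoint.infty ∈ D) : ∃ R : ℝ, ∀ z : ℂ, R ≤ ‖z‖ → z ∈ finitePart D := by
  obtain ⟨R, hR⟩ := ((OnePoint.isOpen_iff_of_mem hinf).1 hD).2.isBounded.subset_ball 0
  refine ⟨R, fun z hz => ?_⟩
  by_contra h
  have := mem_ball_zero_iff.1 (hR h)
  linarith

theorem corollary3p6 (A : ℝ) (hA : 1 ≤ A) (D_seq : ℕ → Set RiemannSphere) (D : Set RiemannSphere)
    (hdom : ∀ n, IsRegion (D_seq n)) (hinf : ∀ n, OnePoint.infty ∈ D_seq n)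
    (hunif : ∀ n, IsUniformCircleDomain A (finitePart (D_seq n)))
    (hD : IsRegion D)
    (hconv : CaratheodoryConverges OnePoint.infty D_seq D) :
    IsUniformCircleDomain A (finitePart D) := by
  obtain ⟨-, hlim⟩ := hconv.planarKernelLimit hD
  have hs : ∀ n, HasSteadyCurves A (finitePart (D_seq n)) := fun n a ha b hb =>
    (hunif n).1.exists_isSteadyCurve hA ha hb
  have hcirc : ∀ n, HasCircularBoundary (finitePart (D_seq n)) := by
    intro n
    obtain ⟨R, hR⟩ := exists_radius_finitePart (hdom n).1 (hinf n)
    exact (hunif n).2.hasCircularBoundary (hunif n).1.1.1 hR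
  have hU := hlim.isUniformDomain hA hs
  obtain ⟨R, -, hR, -⟩ := hlim.exists_radius
  refine ⟨hU, HasCircularBoundary.isCircleDomain hU.1 hR ?_⟩
  exact (hlim.hasSteadyCurves hA hs).hasCircularBoundary hA hU.1 hR fun z hz =>
    hlim.exists_isHoleDisc hA hs (fun n => (hunif n).1.1) hcirc hz
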